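/- Let $d$ be a prime and let $n\ge 1$. The generalized de Bruijn graph $\mathrm{DB}(n,d)$ is the directed multigraph with vertex set $\mathbb{Z}_n=\mathbb{Z}/n\mathbb{Z}$ and with an edge $v\to dv+i$ for every $v\in\mathbb{Z}_n$ and every $i=0,\dots,d-1$. For an integer matrix $M$ with $n$ columns, the finite part of its Smith group is $(R_{\mathbb{Q}}(M)\cap\mathbb{Z}^n)/R_{\mathbb{Z}}(M)$, where $R_F(M)$ is the $F$-span of the rows of $M$. The critical group of a directed multigraph is the finite part of the Smith group of its Laplacian $D-A$, where $A_{v,w}$ is the number of edges from $v$ to $w$ and $D$ is the diagonal matrix of indegrees. Let $\mathcal{Z}_n$ be the additive group of all $a\in\mathbb{Z}[x]/(x^n-1)$ with $a(1)=0$. For $v\in\mathbb{Z}_n$ put $f_v=dx^v-x^{dv}\sum_{i=0}^{d-1}x^i$ and $g_v=(x-1)f_v$, and let $$S(n,d)=\mathcal{Z}_n/\langle f_v : v\in\mathbb{Z}_n,\ v\neq 0\rangle_{\mathbb{Z}},\qquad \Sigma(n,d)=\mathcal{Z}_n/\langle g_v : v\in\mathbb{Z}_n,\ v\neq 0\rangle_{\mathbb{Z}}$$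 ($\Sigma(n,d)$ is called the sand dune group of $\mathrm{DB}(n,d)$). Let $Q_n$ be the $n\times n$ permutation matrix over $\mathbb{F}_d$ of the cyclic permutation $(1,2,\dots,n)$, let $C(n,d)$ be the group of invertible circulant matrices over $\mathbb{F}_d$, that is, of the invertible matrices of the form $a_1Q_n+a_2Q_n^2+\dots+a_nQ_n^n$ with $a_i\in\mathbb{F}_d$, and let $C'(n,d)$ be the subgroup of those $g\in C(n,d)$ with $g\mathbf{1}=\mathbf{1}$, where $\mathbf{1}$ is the all-ones vector. Then: 1. $\Sigma(n,d)\cong C'(n,d)$. 2. $S(n,d)\cong C'(n,d)/\langle Q_n\rangle$, and the critical group of $\mathrm{DB}(n,d)$ is also isomorphic to $C'(n,d)/\langle Q_n\rangle$. 3. The subgroup $H$ of $C(n,d)$ generated by the scalar matrices $\lambda I$ ($\lambda\in\mathbb{F}_d^*$) and $Q_n$ is isomorphic to $\mathbb{Z}_{d-1}\times\mathbb{Z}_n$, and $C(n,d)/H$ is isomorphic to the critical group of $\mathrm{DB}(n,d)$. -/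

import Mathlib

noncomputable section

/-! ### Smith groups of integer matrices -/

/-- The subgroup of `ℤⁿ` generated by the rows of the integer matrix `M`. -/
def rowLattice {m n : Type} (M : Matrix m n ℤ) : Submodule ℤ (n → ℤ) :=
  Submodule.span ℤ (Set.range fun i => M i)

/-- The integer vectors that lie in the rational row space of `M`. -/
def rationalRowLattice {m n : Type} (M : Matrix m n ℤ) : Submodule ℤ (n → ℤ) :=
  ((Submodule.span ℚ (Set.range fun (i : m) (j : n) => (M i j : ℚ))).restrictScalars ℤ).comap
    ((Int.castAddHom ℚ).toIntLinearMap.compLeft n)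

theorem mem_rationalRowLattice {m n : Type} (M : Matrix m n ℤ) (x : n → ℤ) :
    x ∈ rationalRowLattice M ↔ (fun j => (x j : ℚ)) ∈
      Submodule.span ℚ (Set.range fun (i : m) (j : n) => (M i j : ℚ)) :=
  Iff.rfl

/-- The Smith group `ℤⁿ / R_ℤ(M)` of an integer matrix `M`. -/
abbrev smithGroup {m n : Type} (M : Matrix m n ℤ) : Type :=
  (n → ℤ) ⧸ rowLattice M

/-- The finite part `(R_ℚ(M) ∩ ℤⁿ) / R_ℤ(M)` of the Smith group, as a subgroup of it. -/
def smithFinitePart {m n : Type} (M : Matrix m n ℤ) : Submodule ℤ (smithGroup M) :=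
  (rationalRowLattice M).map (rowLattice M).mkQ

/-! ### Directed multigraphs, Laplacians, critical groups -/

/-- A directed graph on the vertex set `V`; multiple edges and loops are allowed. -/
structure MultiDigraph (V : Type) where
  /-- the edges -/
  Edge : Type
  /-- the vertex where an edge starts -/
  source : Edge → V
  /-- the vertex where an edge ends -/
  target : Edge → V

namespace MultiDigraph

variable {V : Type}

/-- The number of edges ending in `v`. -/
def indegree (G : MultiDigraph V) (v : V) : ℕ :=
  Nat.card {e : G.Edge // G.target e = v}

/-- The adjacency matrix: its entry at `(v, w)` is the number of edges from `v` to `w`. -/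
def adjMatrix (G : MultiDigraph V) : Matrix V V ℤ :=
  Matrix.of fun v w => (Nat.card {e : G.Edge // G.source e = v ∧ G.target e = w} : ℤ)

/-- The Laplacian `D - A`, where `D` is the diagonal matrix of indegrees. -/
def laplacian [DecidableEq V] (G : MultiDigraph V) : Matrix V V ℤ :=
  Matrix.diagonal (fun v => (G.indegree v : ℤ)) - G.adjMatrix

/-- The critical group: the finite part of the Smith group of the Laplacian. -/
abbrev criticalGroup [DecidableEq V] (G : MultiDigraph V) : Type :=
  ↥(smithFinitePart G.laplacian)

end MultiDigraph

/-- The generalized de Bruijn graph: vertex set `ℤ/n` and edges `v → d v + i`, `0 ≤ i < d`. -/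
def deBruijnGraph (n d : ℕ) : MultiDigraph (ZMod n) where
  Edge := ZMod n × Fin d
  source := fun e => e.1
  target := fun e => d * e.1 + (e.2 : ℕ)

/-! ### The groups `S(n,d)` and `Σ(n,d)` -/

/-- The ring `ℤ[x] / (x^n - 1)`. -/
abbrev CyclicRing (n : ℕ) : Type :=
  AdjoinRoot ((Polynomial.X : Polynomial ℤ) ^ n - 1)

namespace CyclicRing

/-- The class of `x`. -/
def x (n : ℕ) : CyclicRing n := AdjoinRoot.root _

/-- The monomial `x^v` for a residue class `v` modulo `n`. -/
def xpow (n : ℕ) (v : ZMod n) : CyclicRing n := x n ^ v.val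

/-- The evaluation `a ↦ a(1)`. -/
def evalOne (n : ℕ) : CyclicRing n →+* ℤ :=
  AdjoinRoot.lift (RingHom.id ℤ) 1 (by simp)

theorem evalOne_x (n : ℕ) : evalOne n (x n) = 1 := by
  simp [evalOne, x]

theorem evalOne_xpow (n : ℕ) (v : ZMod n) : evalOne n (xpow n v) = 1 := by
  simp [xpow, evalOne_x]

end CyclicRing

open CyclicRing in
/-- The additive group of all `a` in `ℤ[x] / (x^n - 1)` with `a(1) = 0`. -/
def augGroup (n : ℕ) : AddSubgroup (CyclicRing n) :=
  (evalOne n).toAddMonoidHom.ker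

open CyclicRing in
/-- `f_v = d x^v - x^{dv} (1 + x + ⋯ + x^{d-1})`. -/
def fPoly (n d : ℕ) (v : ZMod n) : augGroup n :=
  ⟨d * xpow n v - xpow n (d * v) * ∑ i ∈ Finset.range d, x n ^ i, by
    change evalOne n _ = 0
    simp [evalOne_x, evalOne_xpow]⟩

open CyclicRing in
/-- `g_v = (x - 1) f_v`. -/
def gPoly (n d : ℕ) (v : ZMod n) : augGroup n :=
  ⟨(x n - 1) * (fPoly n d v : CyclicRing n), by
    change evalOne n _ = 0
    simp [evalOne_x]⟩

/-- `S(n,d)`: the quotient of `augGroup n` by the `ℤ`-span of the `f_v`, `v ≠ 0`. -/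
abbrev sandpileGroup (n d : ℕ) : Type :=
  augGroup n ⧸ AddSubgroup.closure (fPoly n d '' {v | v ≠ 0})

/-- The sand dune group `Σ(n,d)`: the quotient of `augGroup n` by the `ℤ`-span of the `g_v`,
`v ≠ 0`. -/
abbrev sandDuneGroup (n d : ℕ) : Type :=
  augGroup n ⧸ AddSubgroup.closure (gPoly n d '' {v | v ≠ 0})

/-! ### Invertible circulant matrices over `𝔽_p` -/

/-- The permutation matrix `Q_n` of the cyclic permutation `(1, 2, …, n)`: row `i` has its one
in column `i + 1`, cyclically. -/
def cycMatrix (n : ℕ) (F : Type) [Field F] : Matrix (Fin n) (Fin n) F :=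
  (finRotate n).permMatrix F

/-- A circulant matrix is a linear combination `a₁ Q_n + a₂ Q_n² + ⋯ + a_n Q_n^n`. -/
def IsCirculant {n : ℕ} {F : Type} [Field F] (M : Matrix (Fin n) (Fin n) F) : Prop :=
  ∃ a : Fin n → F, M = ∑ i : Fin n, a i • cycMatrix n F ^ ((i : ℕ) + 1)

theorem permMatrix_pow {n : ℕ} {F : Type} [Field F] (σ : Equiv.Perm (Fin n)) (k : ℕ) :
    (σ.permMatrix F) ^ k = (σ ^ k).permMatrix F := by
  induction k with
  | zero => simp
  | succ k ih => rw [pow_succ, ih, pow_succ', ← Matrix.permMatrix_mul]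

theorem cycMatrix_pow_self (n : ℕ) (F : Type) [Field F] : cycMatrix n F ^ n = 1 := by
  rcases n with _ | _ | n
  · simp
  · ext i j
    fin_cases i; fin_cases j
    simp [cycMatrix]
  · rw [cycMatrix, permMatrix_pow]
    have h : finRotate (n + 2) ^ (n + 2) = 1 := by
      have := pow_orderOf_eq_one (finRotate (n + 2))
      rwa [(isCycle_finRotate (n := n)).orderOf, support_finRotate, Finset.card_univ,
        Fintype.card_fin] at this
    rw [h, Matrix.permMatrix_one]

theorem isCirculant_iff_mem_span {n : ℕ} {F : Type} [Field F]
    {M : Matrix (Fin n) (Fin n) F} :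
    IsCirculant M ↔
      M ∈ Submodule.span F (Set.range fun i : Fin n => cycMatrix n F ^ ((i : ℕ) + 1)) := by
  rw [Submodule.mem_span_range_iff_exists_fun]
  exact ⟨fun ⟨a, h⟩ => ⟨a, h.symm⟩, fun ⟨a, h⟩ => ⟨a, h.symm⟩⟩

theorem isCirculant_cycMatrix_pow {n : ℕ} {F : Type} [Field F] (k : ℕ) :
    IsCirculant (cycMatrix n F ^ k) := by
  rw [isCirculant_iff_mem_span]
  rcases Nat.eq_zero_or_pos n with rfl | hn
  · rw [Subsingleton.elim (cycMatrix 0 F ^ k) 0]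
    exact Submodule.zero_mem _
  · refine Submodule.subset_span ⟨⟨(k + (n - 1)) % n, Nat.mod_lt _ hn⟩, ?_⟩
    have h : ∀ j, cycMatrix n F ^ (j % n) = cycMatrix n F ^ j := by
      intro j
      conv_rhs => rw [← Nat.div_add_mod j n]
      rw [pow_add, pow_mul, cycMatrix_pow_self, one_pow, one_mul]
    have h' : k + (n - 1) + 1 = k + n := by omega
    simp only
    rw [pow_succ, h, ← pow_succ, h', pow_add, cycMatrix_pow_self, mul_one]

theorem isCirculant_one {n : ℕ} {F : Type} [Field F] :
    IsCirculant (1 : Matrix (Fin n) (Fin n) F) := by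
  simpa using isCirculant_cycMatrix_pow (n := n) (F := F) 0

theorem isCirculant_cycMatrix {n : ℕ} {F : Type} [Field F] : IsCirculant (cycMatrix n F) := by
  simpa using isCirculant_cycMatrix_pow (n := n) (F := F) 1

theorem IsCirculant.mul {n : ℕ} {F : Type} [Field F] {M N : Matrix (Fin n) (Fin n) F}
    (hM : IsCirculant M) (hN : IsCirculant N) : IsCirculant (M * N) := by
  obtain ⟨a, rfl⟩ := hM
  obtain ⟨b, rfl⟩ := hN
  rw [isCirculant_iff_mem_span, Finset.sum_mul_sum]
  refine Submodule.sum_mem _ fun i _ => Submodule.sum_mem _ fun j _ => ?_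
  rw [smul_mul_smul_comm, ← pow_add]
  exact Submodule.smul_mem _ _ (isCirculant_iff_mem_span.1 (isCirculant_cycMatrix_pow _))

theorem IsCirculant.mul_comm {n : ℕ} {F : Type} [Field F] {M N : Matrix (Fin n) (Fin n) F}
    (hM : IsCirculant M) (hN : IsCirculant N) : M * N = N * M := by
  obtain ⟨a, rfl⟩ := hM
  obtain ⟨b, rfl⟩ := hN
  refine Commute.sum_left _ _ _ fun i _ => Commute.sum_right _ _ _ fun j _ => ?_
  exact ((Commute.pow_pow (Commute.refl _) _ _).smul_left _).smul_right _

section circulantGroups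

variable (n p : ℕ) [Fact p.Prime]

/-- The group `C(n,p)` of invertible `n × n` circulant matrices over `𝔽_p`. -/
def circulantGroup : Subgroup (GL (Fin n) (ZMod p)) where
  carrier := {g | IsCirculant (g : Matrix (Fin n) (Fin n) (ZMod p))}
  mul_mem' := by
    intro g h hg hh
    exact IsCirculant.mul hg hh
  one_mem' := isCirculant_one
  inv_mem' := by
    intro g hg
    have hpow : ∀ k : ℕ,
        IsCirculant ((g ^ k : GL (Fin n) (ZMod p)) : Matrix (Fin n) (Fin n) (ZMod p)) := by
      intro k
      induction k with
      | zero => simpa using isCirculant_one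
      | succ k ih =>
        rw [pow_succ]
        exact IsCirculant.mul ih hg
    have h : g⁻¹ = g ^ (orderOf g - 1) := by
      rw [inv_eq_iff_mul_eq_one, ← pow_succ', Nat.sub_add_cancel (orderOf_pos g),
        pow_orderOf_eq_one]
    change IsCirculant _
    rw [h]
    exact hpow _

instance : IsMulCommutative (circulantGroup n p) :=
  IsMulCommutative.of_setLike_mul_comm fun _ hg _ hh => Units.ext (IsCirculant.mul_comm hg hh)

/-- `Q_n` as an element of `C(n,p)`. -/
def cycUnit : circulantGroup n p :=
  ⟨⟨cycMatrix n (ZMod p), (finRotate n)⁻¹.permMatrix (ZMod p),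
      by rw [cycMatrix, ← Matrix.permMatrix_mul, inv_mul_cancel, Matrix.permMatrix_one],
      by rw [cycMatrix, ← Matrix.permMatrix_mul, mul_inv_cancel, Matrix.permMatrix_one]⟩,
    isCirculant_cycMatrix⟩

/-- The subgroup `C'(n,p)` of those `g` in `C(n,p)` that fix the all-ones vector. -/
def circulantGroupOne : Subgroup (circulantGroup n p) where
  carrier := {g | Matrix.mulVec (g : GL (Fin n) (ZMod p)).val 1 = 1}
  mul_mem' := by
    intro g h hg hh
    change Matrix.mulVec ((g : GL (Fin n) (ZMod p)).val * (h : GL (Fin n) (ZMod p)).val) 1 = 1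
    rw [← Matrix.mulVec_mulVec, hh, hg]
  one_mem' := Matrix.one_mulVec _
  inv_mem' := by
    intro g hg
    change Matrix.mulVec (g : GL (Fin n) (ZMod p)).inv 1 = 1
    have hg' : Matrix.mulVec (g : GL (Fin n) (ZMod p)).val 1 = 1 := hg
    conv_lhs => rw [← hg']
    rw [Matrix.mulVec_mulVec, Units.inv_val, Matrix.one_mulVec]

/-- `Q_n` as an element of `C'(n,p)`. -/
def cycUnitOne : circulantGroupOne n p :=
  ⟨cycUnit n p, by
    change Matrix.mulVec ((finRotate n).permMatrix (ZMod p)) 1 = 1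
    rw [Matrix.permMatrix_mulVec]
    rfl⟩

/-- The subgroup of `C(n,p)` of the scalar matrices `λ I` with `λ` in `𝔽_p^*`. -/
def scalarSubgroup : Subgroup (circulantGroup n p) :=
  (Matrix.GeneralLinearGroup.scalar (Fin n) : (ZMod p)ˣ →* GL (Fin n) (ZMod p)).range.subgroupOf
    (circulantGroup n p)

/-- The subgroup of `C(n,p)` generated by the scalar matrices and `Q_n`. -/
def scalarCycSubgroup : Subgroup (circulantGroup n p) :=
  scalarSubgroup n p ⊔ Subgroup.zpowers (cycUnit n p)

end circulantGroups

end

/-! Write `p` for the prime `d`. The relation `g_k` telescopes, so `Σ(n,p)` is generated by the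
classes `e_v` of `x^v - 1` with the relations `e_0 = 0` and `p e_v = e_{pv}`. A character of `Σ` is
thus a function `w` on `ℤ/n` with `w(0) = 1` and `w(pv) = w(v)^p`. On the other side, circulant
matrices form the ring `𝔽_p[x]/(x^n - 1)`, and `C'` is the group of its units `u` with `u(1) = 1`.

If `p` does not divide `n`, take a primitive `n`-th root of unity `ζ` in the algebraic closure of
`𝔽_p`. A unit `u` gives the function `v ↦ u(ζ^v)`, which satisfies the relation because Frobenius
fixes the coefficients. Lagrange interpolation shows that every character arises this way
(`toCharacter_surjective`). So `C'` is the dual of `Σ`, whose exponent is prime to `p`, and a finite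
abelian group is isomorphic to its dual.

If `n = pm`, both sides reduce surjectively to level `m` with kernel exactly the `p`-torsion, since
multiplication by `p` (respectively the `p`-th power) is the reduction followed by an injection.
Both orders grow by the factor `p^(pm - m)`. A finite abelian group `G` is determined by its order
and by `G / G[p]` (`nonempty_addEquiv_of_quotient_torsion`), so induction on `n` finishes. There is
no natural isomorphism in this step, only a comparison of invariants.

For `S(n,p)`, multiplication by `x - 1` identifies it with the kernel of `Σ → ℤ/n`, `e_v ↦ v`. The
characters trivial on this kernel are the powers of the one given by `x`, so the same two steps
compare the kernel with `C'/⟨Q_n⟩`. The critical group is `S`, because the rows of the Laplacian are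
the coefficient vectors of the `f_v` and `S` is finite. Part 3 follows from the splitting of `C`
into scalars and `C'` by the augmentation. -/

/-! ### Finite abelian groups and their torsion counts -/

section FiniteAbelian

/-- Trivial factors are discarded, since otherwise the family of pairs `(p i, e i)` would not be an
invariant of `G`. -/
theorem exists_pi_zmod_prime_pow (G : Type*) [AddCommGroup G] [Finite G] :
    ∃ (ι : Type) (_ : Fintype ι) (p e : ι → ℕ), (∀ i, (p i).Prime) ∧ (∀ i, 0 < e i) ∧
      Nonempty (G ≃+ ∀ i, ZMod (p i ^ e i)) := by
  classical
  obtain ⟨ι, _, p, hp, e, ⟨f⟩⟩ := AddCommGroup.equiv_directSum_zmod_of_finite G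
  let f' := f.trans (DirectSum.addEquivProd fun i => ZMod (p i ^ e i))
  let r : (∀ i, ZMod (p i ^ e i)) →+ ∀ i : {i // 0 < e i}, ZMod (p i ^ e i) :=
    { toFun := fun x i => x i, map_zero' := rfl, map_add' := fun _ _ => rfl }
  have hr : Function.Bijective r := by
    constructor
    · intro x y h
      funext i
      by_cases hi : 0 < e i
      · exact congrFun h ⟨i, hi⟩
      · have : Subsingleton (ZMod (p i ^ e i)) := by
          rw [Nat.eq_zero_of_not_pos hi, pow_zero]
          infer_instance
        exact Subsingleton.elim _ _
    · intro y
      refine ⟨fun i => if h : 0 < e i then y ⟨i, h⟩ else 0, ?_⟩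
      funext i
      exact dif_pos i.2
  exact ⟨{i // 0 < e i}, inferInstance, fun i => p i, fun i => e i, fun i => hp i, fun i => i.2,
    ⟨f'.trans (AddEquiv.ofBijective r hr)⟩⟩

theorem card_nsmul_ker_congr {G H : Type*} [AddCommGroup G] [AddCommGroup H] (f : G ≃+ H)
    (N : ℕ) :
    Nat.card (nsmulAddMonoidHom N : G →+ G).ker = Nat.card (nsmulAddMonoidHom N : H →+ H).ker :=
  Nat.card_congr (f.toEquiv.subtypeEquiv fun a => by simp [AddMonoidHom.mem_ker, ← map_nsmul])

theorem card_nsmul_ker_one (G : Type*) [AddCommGroup G] :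
    Nat.card (nsmulAddMonoidHom 1 : G →+ G).ker = 1 := by
  rw [AddSubgroup.card_eq_one, eq_bot_iff]
  intro x hx
  simpa [AddMonoidHom.mem_ker] using hx

theorem card_nsmul_ker_pi {ι : Type*} [Fintype ι] (G : ι → Type*) [∀ i, AddCommGroup (G i)]
    (N : ℕ) :
    Nat.card (nsmulAddMonoidHom N : (∀ i, G i) →+ ∀ i, G i).ker =
      ∏ i, Nat.card (nsmulAddMonoidHom N : G i →+ G i).ker := by
  rw [← Nat.card_pi]
  refine Nat.card_congr (Equiv.trans (Equiv.subtypeEquivRight fun x => ?_)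
    (Equiv.subtypePiEquivPi (p := fun i a => a ∈ (nsmulAddMonoidHom N : G i →+ G i).ker)))
  simp only [AddMonoidHom.mem_ker, nsmulAddMonoidHom_apply]
  exact funext_iff

theorem gcd_prime_pow_succ {p q : ℕ} (hp : p.Prime) (hq : q.Prime) (e j : ℕ) :
    (p ^ e).gcd (q ^ (j + 1)) = (p ^ e).gcd (q ^ j) * q ^ (if p = q ∧ j < e then 1 else 0) := by
  by_cases h : p = q
  · subst h
    rw [Nat.gcd_comm, Nat.gcd_comm (p ^ e)]
    by_cases hj : j < e
    · rw [Nat.gcd_eq_left (pow_dvd_pow p hj), Nat.gcd_eq_left (pow_dvd_pow p hj.le),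
        if_pos ⟨rfl, hj⟩, pow_one, pow_succ]
    · rw [Nat.gcd_eq_right (pow_dvd_pow p (by omega)), Nat.gcd_eq_right (pow_dvd_pow p (by omega)),
        if_neg (fun h => hj h.2), pow_zero, mul_one]
  · have : Nat.Coprime p q := (Nat.coprime_primes hp hq).2 h
    rw [if_neg (fun h' => h h'.1), (Nat.Coprime.pow e (j + 1) this).gcd_eq_one,
      (Nat.Coprime.pow e j this).gcd_eq_one, pow_zero, mul_one]

open Finset in
-- A cyclic factor of order `p^e` has `gcd(p^e, q^j)` elements killed by `q^j`. Hence the growth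
-- from `q^j` to `q^(j+1)` counts the `q`-primary factors of exponent above `j`.
theorem card_nsmul_ker_pi_zmod_succ {ι : Type*} [Fintype ι] {p e : ι → ℕ}
    (hp : ∀ i, (p i).Prime) {q : ℕ} (hq : q.Prime) (j : ℕ) :
    Nat.card (nsmulAddMonoidHom (q ^ (j + 1)) :
        (∀ i, ZMod (p i ^ e i)) →+ ∀ i, ZMod (p i ^ e i)).ker =
      Nat.card (nsmulAddMonoidHom (q ^ j) :
        (∀ i, ZMod (p i ^ e i)) →+ ∀ i, ZMod (p i ^ e i)).ker *
      q ^ #{i | p i = q ∧ j < e i} := by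
  have : ∀ i, NeZero (p i ^ e i) := fun i => ⟨(pow_pos (hp i).pos _).ne'⟩
  rw [card_nsmul_ker_pi, card_nsmul_ker_pi, card_filter, ← prod_pow_eq_pow_sum, ← prod_mul_distrib]
  refine prod_congr rfl fun i _ => ?_
  rw [IsAddCyclic.card_nsmulAddMonoidHom_ker, IsAddCyclic.card_nsmulAddMonoidHom_ker, Nat.card_zmod,
    gcd_prime_pow_succ (hp i) hq]

open Finset in
theorem card_filter_eq_succ {ι : Type*} [Fintype ι] (p e : ι → ℕ) (q j : ℕ) :
    #{i | p i = q ∧ j < e i} = #{i | p i = q ∧ j + 1 < e i} + #{i | p i = q ∧ e i = j + 1} := by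
  classical
  rw [← card_union_of_disjoint]
  · congr 1
    ext i
    simp only [mem_filter, mem_univ, true_and, mem_union]
    omega
  · rw [disjoint_filter]
    intro i _ h1 h2
    omega

/-- Finite abelian groups with equally many `N`-torsion elements for all prime powers `N` are
isomorphic. -/
theorem nonempty_addEquiv_of_card_nsmul_ker {G H : Type*} [AddCommGroup G] [AddCommGroup H]
    [Finite G] [Finite H]
    (h : ∀ q j : ℕ, q.Prime → Nat.card (nsmulAddMonoidHom (q ^ j) : G →+ G).ker =
      Nat.card (nsmulAddMonoidHom (q ^ j) : H →+ H).ker) : Nonempty (G ≃+ H) := by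
  classical
  obtain ⟨ι, _, p, e, hp, he, ⟨f⟩⟩ := exists_pi_zmod_prime_pow G
  obtain ⟨κ, _, p', e', hp', he', ⟨f'⟩⟩ := exists_pi_zmod_prime_pow H
  have key : ∀ q j, q.Prime → Finset.card {i | p i = q ∧ j < e i} =
      Finset.card {i | p' i = q ∧ j < e' i} := by
    intro q j hq
    have h1 := card_nsmul_ker_pi_zmod_succ (e := e) hp hq j
    have h2 := card_nsmul_ker_pi_zmod_succ (e := e') hp' hq j
    rw [← card_nsmul_ker_congr f, ← card_nsmul_ker_congr f] at h1
    rw [← card_nsmul_ker_congr f', ← card_nsmul_ker_congr f', ← h q j hq, ← h q (j + 1) hq, h1] at h2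
    exact Nat.pow_right_injective hq.two_le (Nat.eq_of_mul_eq_mul_left Nat.card_pos h2)
  -- The factors of exponent exactly `j + 1` are those above `j` minus those above `j + 1`. At
  -- exponent `0` both fibres are empty because all exponents are positive.
  have key2 : ∀ c : ℕ × ℕ, Nonempty ({i // (p i, e i) = c} ≃ {i // (p' i, e' i) = c}) := by
    rintro ⟨q, j⟩
    refine ⟨Fintype.equivOfCardEq ?_⟩
    rw [Fintype.card_subtype, Fintype.card_subtype]
    simp only [Prod.mk.injEq]
    by_cases hq : q.Prime
    · rcases j with _ | j
      · rw [Finset.filter_false_of_mem, Finset.filter_false_of_mem]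
        · rfl
        · exact fun i _ hi => (he' i).ne' hi.2
        · exact fun i _ hi => (he i).ne' hi.2
      · have h1 := card_filter_eq_succ p e q j
        have h2 := card_filter_eq_succ p' e' q j
        rw [key q j hq, key q (j + 1) hq] at h1
        omega
    · rw [Finset.filter_false_of_mem, Finset.filter_false_of_mem]
      · rfl
      · exact fun i _ hi => hq (hi.1 ▸ hp' i)
      · exact fun i _ hi => hq (hi.1 ▸ hp i)
  let σ : ι ≃ κ := Equiv.ofFiberEquiv (f := fun i => (p i, e i)) (g := fun i => (p' i, e' i))
    fun c => (key2 c).some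
  have hσ : ∀ i, (p' (σ i), e' (σ i)) = (p i, e i) := fun i =>
    Equiv.ofFiberEquiv_map (g := fun i => (p' i, e' i)) _ i
  have hσ' : ∀ i, p i ^ e i = p' (σ i) ^ e' (σ i) := fun i => by
    rw [(Prod.mk.inj (hσ i)).1, (Prod.mk.inj (hσ i)).2]
  let g : (∀ i, ZMod (p i ^ e i)) ≃+ ∀ i, ZMod (p' (σ i) ^ e' (σ i)) :=
    AddEquiv.piCongrRight fun i => (ZMod.ringEquivCongr (hσ' i)).toAddEquiv
  let g' : (∀ i, ZMod (p' i ^ e' i)) ≃+ ∀ i, ZMod (p' (σ i) ^ e' (σ i)) :=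
    { Equiv.piCongrLeft' (fun i => ZMod (p' i ^ e' i)) σ.symm with
      map_add' := fun _ _ => rfl }
  exact ⟨((f.trans g).trans g'.symm).trans f'.symm⟩

/-- Here `K` plays the role of `G / G[p]`. The `p^(j+1)`-torsion of `G` is the full preimage of the
`p^j`-torsion of `K`, so it maps onto it with the same kernel as `φ`. -/
theorem card_nsmul_ker_of_surjective {p : ℕ} {G K : Type*} [AddCommGroup G]
    [AddCommGroup K] [Finite G] (φ : G →+ K) (hφ : Function.Surjective φ)
    (hk : ∀ g, φ g = 0 ↔ p • g = 0) (j : ℕ) :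
    Nat.card (nsmulAddMonoidHom (p ^ (j + 1)) : G →+ G).ker * Nat.card K =
      Nat.card (nsmulAddMonoidHom (p ^ j) : K →+ K).ker * Nat.card G := by
  have hG : Nat.card G = Nat.card K * Nat.card φ.ker := by
    rw [AddSubgroup.card_eq_card_quotient_mul_card_addSubgroup φ.ker,
      Nat.card_congr (QuotientAddGroup.quotientKerEquivOfSurjective φ hφ).toEquiv]
  have hmem : ∀ g, g ∈ (nsmulAddMonoidHom (p ^ (j + 1)) : G →+ G).ker ↔
      φ g ∈ (nsmulAddMonoidHom (p ^ j) : K →+ K).ker := by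
    intro g
    rw [AddMonoidHom.mem_ker, AddMonoidHom.mem_ker, nsmulAddMonoidHom_apply,
      nsmulAddMonoidHom_apply, ← map_nsmul, hk, pow_succ', mul_nsmul']
  let ψ : (nsmulAddMonoidHom (p ^ (j + 1)) : G →+ G).ker →+
      (nsmulAddMonoidHom (p ^ j) : K →+ K).ker :=
    (φ.comp (AddSubgroup.subtype _)).codRestrict _ fun g => (hmem g).1 g.2
  have hψ : Function.Surjective ψ := by
    rintro ⟨k, hk⟩
    obtain ⟨g, rfl⟩ := hφ k
    exact ⟨⟨g, (hmem g).2 hk⟩, rfl⟩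
  have h1 : Nat.card ψ.ker = Nat.card φ.ker := by
    refine Nat.card_congr ⟨fun x => ⟨x.1.1, ?_⟩, fun x => ⟨⟨x.1, ?_⟩, ?_⟩, fun _ => rfl,
      fun _ => rfl⟩
    · exact congrArg Subtype.val x.2
    · rw [hmem, (φ.mem_ker).1 x.2]
      exact AddSubgroup.zero_mem _
    · exact Subtype.ext x.2
  rw [hG, AddSubgroup.card_eq_card_quotient_mul_card_addSubgroup ψ.ker,
    Nat.card_congr (QuotientAddGroup.quotientKerEquivOfSurjective ψ hψ).toEquiv, h1]
  ring

/-- The kernel of `φ` is the `p`-torsion, which meets the `N`-torsion trivially, so `φ` restricts to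
a bijection of the `N`-torsion subgroups. -/
theorem card_nsmul_ker_of_coprime {p N : ℕ} (hpN : p.Coprime N) {G K : Type*} [AddCommGroup G]
    [AddCommGroup K] (φ : G →+ K) (hφ : Function.Surjective φ)
    (hk : ∀ g, φ g = 0 ↔ p • g = 0) :
    Nat.card (nsmulAddMonoidHom N : G →+ G).ker = Nat.card (nsmulAddMonoidHom N : K →+ K).ker := by
  have hz : ∀ g : G, p • g = 0 → N • g = 0 → g = 0 := by
    intro g h1 h2
    have h3 := Nat.dvd_gcd (addOrderOf_dvd_of_nsmul_eq_zero h1) (addOrderOf_dvd_of_nsmul_eq_zero h2)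
    rw [hpN.gcd_eq_one, Nat.dvd_one] at h3
    exact AddMonoid.addOrderOf_eq_one_iff.1 h3
  refine Nat.card_congr (Equiv.ofBijective
    (fun g => ⟨φ g, ?_⟩) ⟨?_, ?_⟩)
  · rw [AddMonoidHom.mem_ker, nsmulAddMonoidHom_apply, ← map_nsmul]
    have := g.2
    rw [AddMonoidHom.mem_ker, nsmulAddMonoidHom_apply] at this
    rw [this, map_zero]
  · rintro ⟨g, hg⟩ ⟨g', hg'⟩ h
    rw [Subtype.mk.injEq] at h ⊢
    rw [AddMonoidHom.mem_ker, nsmulAddMonoidHom_apply] at hg hg'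
    refine sub_eq_zero.1 (hz _ ((hk _).1 (by rw [map_sub]; exact sub_eq_zero.2 h)) ?_)
    rw [nsmul_sub, hg, hg', sub_zero]
  · rintro ⟨k, hk'⟩
    rw [AddMonoidHom.mem_ker, nsmulAddMonoidHom_apply] at hk'
    obtain ⟨g, rfl⟩ := hφ k
    have hN : p • N • g = 0 := by rw [← hk, map_nsmul, hk']
    -- By Bézout, `gcdA • p • g` differs from `g` by a multiple of `N • g`, which `φ` kills. It is
    -- therefore a lift of the same element, and it is itself killed by `N`.
    have hb : (p : ℤ) * p.gcdA N + N * p.gcdB N = 1 := by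
      rw [← Nat.gcd_eq_gcd_ab, hpN.gcd_eq_one, Nat.cast_one]
    refine ⟨⟨p.gcdA N • p • g, ?_⟩, Subtype.ext ?_⟩
    · rw [AddMonoidHom.mem_ker, nsmulAddMonoidHom_apply, smul_comm N, smul_comm N, hN, smul_zero]
    · have h1 : p.gcdA N • p • g = g - p.gcdB N • N • g := by
        rw [eq_sub_iff_add_eq, ← natCast_zsmul, ← natCast_zsmul, smul_smul, smul_smul, ← add_smul,
          mul_comm, mul_comm (p.gcdB N), hb, one_smul]
      simp only [h1]
      rw [map_sub, map_zsmul, map_nsmul, hk', smul_zero, sub_zero]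

/-- Finite abelian groups of equal order whose quotients by the `p`-torsion are isomorphic are
isomorphic. -/
theorem nonempty_addEquiv_of_quotient_torsion {p : ℕ} (hp : p.Prime) {G H K L : Type*}
    [AddCommGroup G] [AddCommGroup H] [AddCommGroup K] [AddCommGroup L] [Finite G] [Finite H]
    (φ : G →+ K) (hφ : Function.Surjective φ) (hφk : ∀ g, φ g = 0 ↔ p • g = 0)
    (ψ : H →+ L) (hψ : Function.Surjective ψ) (hψk : ∀ g, ψ g = 0 ↔ p • g = 0)
    (e : Nonempty (K ≃+ L)) (hc : Nat.card G = Nat.card H) : Nonempty (G ≃+ H) := by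
  obtain ⟨e⟩ := e
  refine nonempty_addEquiv_of_card_nsmul_ker fun q j hq => ?_
  by_cases hqp : q = p
  · subst hqp
    rcases j with _ | j
    · rw [pow_zero, card_nsmul_ker_one, card_nsmul_ker_one]
    · have h1 := card_nsmul_ker_of_surjective φ hφ hφk j
      have h2 := card_nsmul_ker_of_surjective ψ hψ hψk j
      have : Finite K := Finite.of_surjective _ hφ
      rw [card_nsmul_ker_congr e, Nat.card_congr e.toEquiv, hc, ← h2] at h1
      have : Finite L := Finite.of_surjective _ hψ
      exact Nat.eq_of_mul_eq_mul_right Nat.card_pos h1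
  · have hco : p.Coprime (q ^ j) := ((Nat.coprime_primes hp hq).2 (Ne.symm hqp)).pow_right j
    rw [card_nsmul_ker_of_coprime hco φ hφ hφk, card_nsmul_ker_of_coprime hco ψ hψ hψk,
      card_nsmul_ker_congr e]

end FiniteAbelian

noncomputable section

/-! ### The ring `R[x] / (x^n - 1)` -/

section CyclicBasis

open Polynomial

variable (n : ℕ) (R : Type*) [CommRing R]

theorem root_X_pow_sub_one_pow_self : AdjoinRoot.root ((X : R[X]) ^ n - 1) ^ n = 1 := by
  have h := AdjoinRoot.mk_self (f := (X : R[X]) ^ n - 1)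
  rwa [map_sub, map_pow, AdjoinRoot.mk_X, map_one, sub_eq_zero] at h

theorem root_X_pow_sub_one_pow_val (k : ℕ) :
    AdjoinRoot.root ((X : R[X]) ^ n - 1) ^ (k : ZMod n).val =
      AdjoinRoot.root ((X : R[X]) ^ n - 1) ^ k := by
  rw [ZMod.val_natCast]
  conv_rhs => rw [← Nat.div_add_mod k n]
  rw [pow_add, pow_mul, root_X_pow_sub_one_pow_self, one_pow, one_mul]

/-- The basis `x^v` of `R[x] / (x^n - 1)`, indexed by the residue classes modulo `n`. -/
def cyclicBasis [Nontrivial R] [NeZero n] :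
    Module.Basis (ZMod n) R (AdjoinRoot ((X : R[X]) ^ n - 1)) :=
  have hm : ((X : R[X]) ^ n - 1).Monic := monic_X_pow_sub_C 1 (NeZero.ne n)
  have hd : ((X : R[X]) ^ n - 1).natDegree = n := natDegree_X_pow_sub_C (r := (1 : R))
  (AdjoinRoot.powerBasis' hm).basis.reindex
    { toFun := fun i => ((i : ℕ) : ZMod n)
      invFun := fun v => ⟨v.val, lt_of_lt_of_eq (ZMod.val_lt v) hd.symm⟩
      left_inv := fun i => Fin.ext (ZMod.val_cast_of_lt (lt_of_lt_of_eq i.2 hd))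
      right_inv := fun v => ZMod.natCast_zmod_val v }

theorem cyclicBasis_apply [Nontrivial R] [NeZero n] (v : ZMod n) :
    cyclicBasis n R v = AdjoinRoot.root ((X : R[X]) ^ n - 1) ^ v.val := by
  simp only [cyclicBasis, Module.Basis.coe_reindex, Function.comp_apply, Equiv.coe_fn_symm_mk,
    PowerBasis.coe_basis]
  rfl

end CyclicBasis

/-! ### The augmentation ideal -/

namespace CyclicRing

open Finset

variable (n : ℕ)

theorem mem_augGroup {n : ℕ} {a : CyclicRing n} : a ∈ augGroup n ↔ evalOne n a = 0 := Iff.rfl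

theorem x_pow_self : x n ^ n = 1 := root_X_pow_sub_one_pow_self n ℤ

theorem xpow_natCast (k : ℕ) : xpow n k = x n ^ k := root_X_pow_sub_one_pow_val n ℤ k

theorem cyclicBasis_eq_xpow [NeZero n] (v : ZMod n) : cyclicBasis n ℤ v = xpow n v :=
  cyclicBasis_apply n ℤ v

/-- `x^k - 1` as an element of the augmentation ideal. -/
def xdiff (k : ℕ) : augGroup n :=
  ⟨x n ^ k - 1, by
    simp [mem_augGroup, evalOne_x]⟩

theorem xdiff_self : xdiff n n = 0 := Subtype.ext (by simp [xdiff, x_pow_self])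

theorem xdiff_zero : xdiff n 0 = 0 := Subtype.ext (by simp [xdiff])

theorem evalOne_eq_sum [NeZero n] (a : CyclicRing n) :
    evalOne n a = ∑ v, (cyclicBasis n ℤ).repr a v := by
  conv_lhs => rw [← (cyclicBasis n ℤ).sum_repr a]
  simp [cyclicBasis_eq_xpow, evalOne_xpow]

theorem augGroup_eq_sum [NeZero n] (a : augGroup n) :
    a = ∑ v : ZMod n, (cyclicBasis n ℤ).repr a v • xdiff n v.val := by
  have ha : evalOne n (a : CyclicRing n) = 0 := a.2
  refine Subtype.ext ?_
  rw [AddSubgroup.val_finsetSum]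
  conv_lhs => rw [← (cyclicBasis n ℤ).sum_repr a]
  rw [evalOne_eq_sum] at ha
  simp only [AddSubgroup.coe_zsmul, xdiff, smul_sub, sum_sub_distrib, cyclicBasis_eq_xpow, ← sum_smul,
    ha, zero_smul, sub_zero]
  rfl

theorem closure_xdiff_eq_top [NeZero n] :
    AddSubgroup.closure (Set.range fun v : ZMod n => xdiff n v.val) = ⊤ := by
  rw [eq_top_iff]
  intro a _
  rw [augGroup_eq_sum n a]
  exact sum_mem fun v _ => zsmul_mem (AddSubgroup.subset_closure (Set.mem_range_self v)) _

/-- Multiplication by `x - 1` on the augmentation ideal. -/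
def mulXSubOne : augGroup n →+ augGroup n :=
  ((AddMonoidHom.mulLeft (x n - 1)).comp (augGroup n).subtype).codRestrict _ fun a => by
    simp [mem_augGroup, evalOne_x]

theorem coe_mulXSubOne (a : augGroup n) :
    (mulXSubOne n a : CyclicRing n) = (x n - 1) * (a : CyclicRing n) := rfl

open Polynomial in
-- If `x^n - 1` divides `(x - 1) P`, then `P = (1 + ⋯ + x^(n-1)) T`. Now `P(1) = n T(1) = 0` forces
-- `x - 1 ∣ T`, hence `x^n - 1 ∣ P`.
theorem mulXSubOne_injective [NeZero n] : Function.Injective (mulXSubOne n) := by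
  rw [injective_iff_map_eq_zero]
  rintro ⟨a, ha⟩ h
  have h0 : (x n - 1) * a = 0 := congrArg Subtype.val h
  obtain ⟨P, rfl⟩ := AdjoinRoot.mk_surjective a
  have hP : P.eval 1 = 0 := by
    rwa [mem_augGroup, evalOne, AdjoinRoot.lift_mk] at ha
  have hx : x n - 1 = AdjoinRoot.mk _ (X - 1) := by simp [x]
  rw [hx, ← map_mul, AdjoinRoot.mk_eq_zero, ← mul_geom_sum] at h0
  have hX : (X - 1 : ℤ[X]) ≠ 0 := X_sub_C_ne_zero 1
  obtain ⟨T, rfl⟩ := (mul_dvd_mul_iff_left hX).1 h0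
  have hT : T.eval 1 = 0 := by
    simpa [eval_geom_sum, NeZero.ne n] using hP
  refine Subtype.ext (AdjoinRoot.mk_eq_zero.2 ?_)
  rw [← geom_sum_mul]
  exact mul_dvd_mul_left _ (dvd_iff_isRoot.2 hT)

variable (d : ℕ)

/-- With `(x - 1)(1 + ⋯ + x^(d-1)) = x^d - 1`, the relation becomes a difference of the values of `d
(x^k - 1) - (x^(dk) - 1)` at consecutive `k`. All telescoping below rests on this. -/
theorem gPoly_natCast (k : ℕ) :
    gPoly n d k = d • (xdiff n (k + 1) - xdiff n k) - (xdiff n (d * (k + 1)) - xdiff n (d * k)) := by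
  refine Subtype.ext ?_
  have h : (x n - 1) * ∑ i ∈ range d, x n ^ i = x n ^ d - 1 := mul_geom_sum _ _
  have h1 : xpow n ((d : ZMod n) * k) = x n ^ (d * k) := by
    rw [← Nat.cast_mul, xpow_natCast]
  simp only [gPoly, fPoly, xdiff, AddSubgroup.coe_sub, AddSubgroup.coe_nsmul, h1, xpow_natCast,
    nsmul_eq_mul]
  linear_combination (-x n ^ (d * k)) * h

theorem sum_gPoly : ∑ k ∈ range n, gPoly n d k = 0 := by
  simp only [gPoly_natCast]
  rw [sum_sub_distrib, ← smul_sum, sum_range_sub, sum_range_sub (fun k => xdiff n (d * k))]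
  have : xdiff n (d * n) = 0 := Subtype.ext (by simp [xdiff, pow_mul', x_pow_self])
  rw [this, mul_zero, xdiff_self, xdiff_zero]
  simp

theorem sum_fPoly [NeZero n] : ∑ k ∈ range n, fPoly n d k = 0 := by
  apply mulXSubOne_injective
  rw [map_sum, map_zero]
  exact sum_gPoly n d

end CyclicRing

/-- The element at `0` is minus the sum of the others, so leaving it out loses nothing. -/
theorem closure_image_ne_zero_eq {n : ℕ} [NeZero n] {A : Type*} [AddCommGroup A] (f : ZMod n → A)
    (h : ∑ k ∈ Finset.range n, f k = 0) :
    AddSubgroup.closure (f '' {v | v ≠ 0}) = AddSubgroup.closure (Set.range f) := by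
  refine le_antisymm (AddSubgroup.closure_mono (Set.image_subset_range _ _)) ?_
  rw [AddSubgroup.closure_le]
  rintro _ ⟨v, rfl⟩
  by_cases hv : v = 0
  · obtain ⟨m, rfl⟩ := Nat.exists_eq_succ_of_ne_zero (NeZero.ne n)
    rw [Finset.sum_range_succ', add_comm, Nat.cast_zero, add_eq_zero_iff_eq_neg] at h
    rw [hv, h]
    refine neg_mem (sum_mem fun k hk => AddSubgroup.subset_closure ⟨_, ?_, rfl⟩)
    rw [Set.mem_ofPred_eq, Ne, ZMod.natCast_eq_zero_iff]
    exact Nat.not_dvd_of_pos_of_lt k.succ_pos (Nat.succ_lt_succ (Finset.mem_range.1 hk))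
  · exact AddSubgroup.subset_closure ⟨v, hv, rfl⟩

/-! ### Generators and the universal property of the sand dune group -/

namespace SandDune

open CyclicRing Finset

variable (n d : ℕ)

/-- The class of `x^v - 1` in the sand dune group. -/
def gen (v : ZMod n) : sandDuneGroup n d := QuotientAddGroup.mk (xdiff n v.val)

theorem gen_natCast (k : ℕ) : gen n d k = QuotientAddGroup.mk (xdiff n k) :=
  congrArg _ (Subtype.ext (congrArg (· - 1) (xpow_natCast n k)))

theorem gen_zero : gen n d 0 = 0 := by
  have h := gen_natCast n d 0
  rw [Nat.cast_zero, xdiff_zero] at h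
  exact h

theorem closure_gen [NeZero n] : AddSubgroup.closure (Set.range (gen n d)) = ⊤ := by
  have h := congrArg (AddSubgroup.map (QuotientAddGroup.mk'
    (AddSubgroup.closure (gPoly n d '' {v | v ≠ 0})))) (closure_xdiff_eq_top n)
  rw [AddMonoidHom.map_closure, ← Set.range_comp, AddSubgroup.map_top_of_surjective _
    (QuotientAddGroup.mk'_surjective _)] at h
  exact h

theorem induction [NeZero n] {P : sandDuneGroup n d → Prop} (h0 : P 0) (hg : ∀ v, P (gen n d v))
    (ha : ∀ a b, P a → P b → P (a + b)) (hn : ∀ a, P a → P (-a)) (a : sandDuneGroup n d) : P a := by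
  have h : a ∈ AddSubgroup.closure (Set.range (gen n d)) := closure_gen n d ▸ AddSubgroup.mem_top a
  induction h using AddSubgroup.closure_induction with
  | mem x hx => obtain ⟨v, rfl⟩ := hx; exact hg v
  | zero => exact h0
  | add x y _ _ hx hy => exact ha x y hx hy
  | neg x _ hx => exact hn x hx

theorem hom_ext [NeZero n] {M : Type*} [AddCommGroup M] {φ ψ : sandDuneGroup n d →+ M}
    (h : ∀ v, φ (gen n d v) = ψ (gen n d v)) : φ = ψ := by
  refine DFunLike.ext _ _ fun a => ?_
  refine induction n d (P := fun a => φ a = ψ a) ?_ h ?_ ?_ a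
  · simp
  · intro a b ha hb
    simp [ha, hb]
  · intro a ha
    simp [ha]

theorem mk_gPoly [NeZero n] (v : ZMod n) :
    (QuotientAddGroup.mk (gPoly n d v) : sandDuneGroup n d) = 0 := by
  rw [QuotientAddGroup.eq_zero_iff, closure_image_ne_zero_eq _ (sum_gPoly n d)]
  exact AddSubgroup.subset_closure ⟨v, rfl⟩

/-- The relation `g_k` says that `d • gen k - gen (d k)` has the same value at `k + 1` and at `k`,
and this value is `0` at `k = 0`. -/
theorem nsmul_gen [NeZero n] (v : ZMod n) : d • gen n d v = gen n d (d * v) := by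
  rw [← ZMod.natCast_zmod_val v]
  induction v.val with
  | zero => simp [gen_zero]
  | succ k ih =>
    have h := mk_gPoly n d k
    rw [gPoly_natCast] at h
    simp only [QuotientAddGroup.mk_sub, QuotientAddGroup.mk_nsmul, ← gen_natCast] at h
    rw [nsmul_sub, ih, ← Nat.cast_mul, sub_sub_sub_cancel_right, sub_eq_zero] at h
    rw [h, Nat.cast_mul]

theorem mk_mulXSubOne_xdiff (k : ℕ) :
    (QuotientAddGroup.mk (mulXSubOne n (xdiff n k)) : sandDuneGroup n d) =
      gen n d (k + 1 : ℕ) - gen n d k - gen n d (1 : ℕ) := by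
  rw [gen_natCast, gen_natCast, gen_natCast, ← QuotientAddGroup.mk_sub, ← QuotientAddGroup.mk_sub]
  refine congrArg _ (Subtype.ext ?_)
  simp only [coe_mulXSubOne, xdiff, AddSubgroup.coe_sub]
  ring

section lift

variable {n d} {M : Type*} [AddCommGroup M] [NeZero n]

/-- The homomorphism from the sand dune group that takes `gen v` to `u v`. -/
def lift (u : ZMod n → M) (h : ∀ v, u (d * v) = d • u v) : sandDuneGroup n d →+ M :=
  QuotientAddGroup.lift _
    (((cyclicBasis n ℤ).constr ℤ u).toAddMonoidHom.comp (augGroup n).subtype) (by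
      rw [closure_image_ne_zero_eq _ (sum_gPoly n d), AddSubgroup.closure_le]
      rintro _ ⟨v, rfl⟩
      obtain ⟨k, rfl⟩ : ∃ k : ℕ, (k : ZMod n) = v := ⟨_, ZMod.natCast_zmod_val v⟩
      have hu : ∀ k : ℕ, (cyclicBasis n ℤ).constr ℤ u (x n ^ k) = u k := by
        intro k
        rw [← xpow_natCast, ← cyclicBasis_eq_xpow, Module.Basis.constr_basis]
      rw [SetLike.mem_coe, AddMonoidHom.mem_ker, gPoly_natCast]
      simp only [xdiff, AddMonoidHom.comp_apply, AddSubgroup.subtype_apply,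
        LinearMap.toAddMonoidHom_coe, sub_sub_sub_cancel_right, map_sub,
        map_nsmul, hu, Nat.cast_mul, h, ← smul_sub, sub_self])

/-- As `gen v` is the class of `x^v - x^0`, the lift gives `u v - u 0`. This is why `h0` is needed
here and not for `lift` itself. -/
theorem lift_gen (u : ZMod n → M) (h : ∀ v, u (d * v) = d • u v) (h0 : u 0 = 0) (v : ZMod n) :
    lift u h (gen n d v) = u v := by
  have hu : ∀ v, (cyclicBasis n ℤ).constr ℤ u (xpow n v) = u v := by
    intro v
    rw [← cyclicBasis_eq_xpow, Module.Basis.constr_basis]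
  change (cyclicBasis n ℤ).constr ℤ u (xpow n v - 1) = u v
  have h1 : (1 : CyclicRing n) = xpow n 0 := by simp [xpow]
  rw [map_sub, h1, hu, hu, h0, sub_zero]

end lift

variable [NeZero n]

/-- The homomorphism `gen v ↦ v` to `ℤ/n`. -/
def toZMod : sandDuneGroup n d →+ ZMod n := lift id fun v => by simp

theorem toZMod_gen (v : ZMod n) : toZMod n d (gen n d v) = v := lift_gen _ _ rfl v

theorem toZMod_surjective : Function.Surjective (toZMod n d) := fun v => ⟨_, toZMod_gen n d v⟩

/-- Modulo the range, `gen (k + 1)` is `gen k + gen 1`, so every class is `m • gen 1` with `m` a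
lift of its image in `ℤ/n`. Moreover `n • gen 1` lies in the range because `gen n = gen 0 = 0`. -/
theorem range_mk_comp_mulXSubOne :
    ((QuotientAddGroup.mk' (AddSubgroup.closure (gPoly n d '' {v | v ≠ 0}))).comp
      (mulXSubOne n)).range = (toZMod n d).ker := by
  set φ := (QuotientAddGroup.mk' (AddSubgroup.closure (gPoly n d '' {v | v ≠ 0}))).comp
      (mulXSubOne n) with hφ
  have hx : ∀ k : ℕ, φ (xdiff n k) = gen n d (k + 1 : ℕ) - gen n d k - gen n d (1 : ℕ) :=
    mk_mulXSubOne_xdiff n d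
  apply le_antisymm
  · rintro _ ⟨a, rfl⟩
    rw [augGroup_eq_sum n a, map_sum]
    refine sum_mem fun v _ => ?_
    rw [map_zsmul]
    refine zsmul_mem ?_ _
    rw [hx, AddMonoidHom.mem_ker, map_sub, map_sub, toZMod_gen, toZMod_gen, toZMod_gen]
    push_cast
    ring
  · have hgen : ∀ k : ℕ, gen n d k - (k : ℤ) • gen n d (1 : ℕ) ∈ φ.range := by
      intro k
      induction k with
      | zero => simp [gen_zero]
      | succ k ih =>
        have h := add_mem ih ⟨_, hx k⟩
        convert h using 1
        rw [Nat.cast_succ (R := ℤ), add_zsmul, one_zsmul]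
        abel
    have key : ∀ σ, ∃ m : ℤ, σ - m • gen n d (1 : ℕ) ∈ φ.range ∧ (m : ZMod n) = toZMod n d σ := by
      refine induction n d ⟨0, by simp, by simp⟩ ?_ ?_ ?_
      · intro v
        refine ⟨(v.val : ℕ), ?_, ?_⟩
        · simpa using hgen v.val
        · simp [toZMod_gen]
      · rintro a b ⟨m, hm, hm'⟩ ⟨l, hl, hl'⟩
        refine ⟨m + l, ?_, by simp [hm', hl']⟩
        convert add_mem hm hl using 1
        rw [add_zsmul]
        abel
      · rintro a ⟨m, hm, hm'⟩
        refine ⟨-m, ?_, by simp [hm']⟩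
        convert neg_mem hm using 1
        rw [neg_zsmul]
        abel
    intro σ hσ
    obtain ⟨m, hm, hm'⟩ := key σ
    rw [AddMonoidHom.mem_ker] at hσ
    rw [hσ, ZMod.intCast_zmod_eq_zero_iff_dvd] at hm'
    obtain ⟨l, rfl⟩ := hm'
    have hn : (n : ℤ) • gen n d (1 : ℕ) ∈ φ.range := by
      have := hgen n
      rw [ZMod.natCast_self, gen_zero, zero_sub] at this
      simpa using this
    rw [mul_zsmul'] at hm
    have h := add_mem hm (zsmul_mem hn l)
    rwa [smul_comm, sub_add_cancel] at h

/-- Multiplication by `x - 1` is injective and carries each `f_v` to `g_v`. -/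
theorem ker_mk_comp_mulXSubOne :
    ((QuotientAddGroup.mk' (AddSubgroup.closure (gPoly n d '' {v | v ≠ 0}))).comp
      (mulXSubOne n)).ker = AddSubgroup.closure (fPoly n d '' {v | v ≠ 0}) := by
  rw [← AddMonoidHom.comap_ker, QuotientAddGroup.ker_mk']
  have : gPoly n d '' {v | v ≠ 0} = mulXSubOne n '' (fPoly n d '' {v | v ≠ 0}) := by
    rw [Set.image_image]
    rfl
  rw [this, ← AddMonoidHom.map_closure,
    AddSubgroup.comap_map_eq_self_of_injective (mulXSubOne_injective n)]

theorem nonempty_sandpileGroup_addEquiv : Nonempty (sandpileGroup n d ≃+ (toZMod n d).ker) :=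
  ⟨(QuotientAddGroup.quotientAddEquivOfEq (ker_mk_comp_mulXSubOne n d).symm).trans
    ((QuotientAddGroup.quotientKerEquivRange _).trans
      (AddEquiv.addSubgroupCongr (range_mk_comp_mulXSubOne n d)))⟩

end SandDune

end

noncomputable section

/-! ### Finiteness of the sand dune group -/

namespace SandDune

variable (n d : ℕ) [NeZero n]

theorem pow_nsmul_gen (k : ℕ) (v : ZMod n) : d ^ k • gen n d v = gen n d (d ^ k * v) := by
  induction k with
  | zero => simp
  | succ k ih => rw [pow_succ', mul_nsmul', ih, nsmul_gen, pow_succ', mul_assoc]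

theorem nsmul_eq_zero_of_pow_eq {i j : ℕ} (hij : d ^ i ≤ d ^ j)
    (h : (d : ZMod n) ^ i = (d : ZMod n) ^ j) (σ : sandDuneGroup n d) :
    (d ^ j - d ^ i) • σ = 0 := by
  induction σ using induction n d with
  | h0 => simp
  | hg v => rw [sub_nsmul _ hij, ← sub_eq_add_neg, pow_nsmul_gen, pow_nsmul_gen, h, sub_self]
  | ha a b ha hb => rw [nsmul_add, ha, hb, add_zero]
  | hn a ha => rw [neg_nsmul, ha, neg_zero]

/-- The powers of `d` repeat in `ℤ/n`, and `d^k` acts on generators by moving the index; `2 ≤ d`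
makes the resulting `d^j - d^i` positive. -/
theorem exists_nsmul_eq_zero (hd : 2 ≤ d) :
    ∃ N : ℕ, 0 < N ∧ ∀ σ : sandDuneGroup n d, N • σ = 0 := by
  obtain ⟨i, j, hij, h⟩ := Finite.exists_ne_map_eq_of_infinite fun k : ℕ => (d : ZMod n) ^ k
  wlog hlt : i < j generalizing i j
  · exact this j i hij.symm h.symm (by omega)
  · have := Nat.pow_lt_pow_right hd hlt
    exact ⟨_, Nat.sub_pos_of_lt this, nsmul_eq_zero_of_pow_eq n d this.le h⟩

theorem finite (hd : 2 ≤ d) : Finite (sandDuneGroup n d) := by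
  have : AddGroup.FG (sandDuneGroup n d) :=
    AddGroup.fg_iff.2 ⟨_, closure_gen n d, Set.finite_range _⟩
  obtain ⟨N, hN, h⟩ := exists_nsmul_eq_zero n d hd
  refine AddCommGroup.finite_of_fg_isAddTorsion _ fun σ => ?_
  exact isOfFinAddOrder_iff_nsmul_eq_zero.2 ⟨N, hN, h σ⟩

end SandDune

/-! ### The critical group of the generalized de Bruijn graph -/

namespace deBruijnGraph

open CyclicRing Finset

variable (n d : ℕ) [NeZero n]

/-- Pairs `(v, i)` are the integers `d v + i` in `[0, dn)`. Division of these by `n` shows that each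
residue modulo `n` occurs `d` times. -/
theorem indegree_eq (w : ZMod n) : (deBruijnGraph n d).indegree w = d := by
  let f : ZMod n ≃ Fin n :=
    { toFun := fun v => ⟨v.val, ZMod.val_lt v⟩
      invFun := fun i => ((i : ℕ) : ZMod n)
      left_inv := fun v => ZMod.natCast_zmod_val v
      right_inv := fun i => Fin.ext (ZMod.val_cast_of_lt i.2) }
  let e : ZMod n × Fin d ≃ Fin d × Fin n :=
    (((f.prodCongr (Equiv.refl _)).trans finProdFinEquiv).trans
      (finCongr (mul_comm n d))).trans finProdFinEquiv.symm
  have he (x : ZMod n × Fin d) : (((e x).2 : ℕ) : ZMod n) = d * x.1 + (x.2 : ℕ) := by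
    have h : ((e x).2 : ℕ) = (x.2 + d * x.1.val) % n := rfl
    rw [h, ZMod.natCast_mod, Nat.cast_add, Nat.cast_mul, ZMod.natCast_zmod_val, add_comm]
  refine (Nat.card_congr ((e.subtypeEquiv (p := fun x => (deBruijnGraph n d).target x = w)
    (q := fun y => y.2 = f w) fun x => ?_).trans
    ⟨fun y => y.1.1, fun i => ⟨(i, f w), rfl⟩, fun y => Subtype.ext (Prod.ext rfl y.2.symm),
      fun _ => rfl⟩)).trans (Nat.card_fin d)
  rw [← f.symm_apply_eq]
  exact Eq.congr_left (he x).symm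

theorem fPoly_eq (v : ZMod n) :
    (fPoly n d v : CyclicRing n) = d • xpow n v - ∑ i : Fin d, xpow n (d * v + (i : ℕ)) := by
  have h (i : ℕ) : xpow n (d * v + i) = xpow n (d * v) * x n ^ i := by
    obtain ⟨k, hk⟩ : ∃ k : ℕ, (k : ZMod n) = d * v := ⟨_, ZMod.natCast_zmod_val _⟩
    rw [← hk, ← Nat.cast_add, xpow_natCast, xpow_natCast, pow_add]
  simp only [fPoly, h, ← mul_sum, nsmul_eq_mul]
  rw [Finset.sum_range]

/-- The coefficient vector of an element of the augmentation ideal. -/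
def coeffs : augGroup n →+ (ZMod n → ℤ) :=
  (cyclicBasis n ℤ).equivFun.toLinearMap.toAddMonoidHom.comp (augGroup n).subtype

theorem coeffs_apply (a : augGroup n) : coeffs n a = (cyclicBasis n ℤ).equivFun a := rfl

theorem coeffs_injective : Function.Injective (coeffs n) :=
  (cyclicBasis n ℤ).equivFun.injective.comp Subtype.val_injective

theorem mem_range_coeffs (y : ZMod n → ℤ) : y ∈ (coeffs n).range ↔ ∑ v, y v = 0 := by
  constructor
  · rintro ⟨a, rfl⟩
    have ha := mem_augGroup.1 a.2
    rwa [evalOne_eq_sum] at ha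
  · intro h
    refine ⟨⟨(cyclicBasis n ℤ).equivFun.symm y, ?_⟩, (cyclicBasis n ℤ).equivFun.apply_symm_apply y⟩
    rw [mem_augGroup, evalOne_eq_sum, ← h]
    refine sum_congr rfl fun v _ => ?_
    rw [← Module.Basis.equivFun_apply, LinearEquiv.apply_symm_apply]

/-- The link between the graph and the polynomials. The diagonal term matches because every indegree
equals `d`. -/
theorem coeffs_fPoly (v : ZMod n) : coeffs n (fPoly n d v) = (deBruijnGraph n d).laplacian v := by
  funext w
  have hx (v : ZMod n) : (cyclicBasis n ℤ).equivFun (xpow n v) = Pi.single v 1 := by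
    rw [← cyclicBasis_eq_xpow]
    funext w
    rw [Module.Basis.equivFun_self, Pi.single_apply]
    simp only [eq_comm]
  have hadj : Nat.card {e : (deBruijnGraph n d).Edge // (deBruijnGraph n d).source e = v ∧
      (deBruijnGraph n d).target e = w} = #{i : Fin d | (d : ZMod n) * v + (i : ℕ) = w} := by
    rw [← Fintype.card_subtype, ← Nat.card_eq_fintype_card]
    refine Nat.card_congr ⟨fun e => ⟨e.1.2, ?_⟩, fun i => ⟨(v, i), rfl, i.2⟩, ?_, fun _ => rfl⟩
    · obtain ⟨⟨v', i⟩, h1, h2⟩ := e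
      exact h1 ▸ h2
    · rintro ⟨⟨v', i⟩, h1, h2⟩
      exact Subtype.ext (Prod.ext h1.symm rfl)
  rw [coeffs_apply, fPoly_eq, map_sub, map_nsmul, map_sum, MultiDigraph.laplacian,
    Matrix.sub_apply, MultiDigraph.adjMatrix, Matrix.of_apply, hadj, Matrix.diagonal_apply,
    indegree_eq, Pi.sub_apply, Finset.sum_apply, Finset.card_filter]
  push_cast
  congr 1
  · rw [hx, Pi.smul_apply, Pi.single_apply]
    simp only [eq_comm (a := w)]
    split_ifs <;> simp
  · refine sum_congr rfl fun i _ => ?_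
    rw [hx, Pi.single_apply]
    simp only [eq_comm (a := w)]

theorem rowLattice_laplacian :
    (rowLattice (deBruijnGraph n d).laplacian).toAddSubgroup =
      (AddSubgroup.closure (Set.range (fPoly n d))).map (coeffs n) := by
  rw [AddMonoidHom.map_closure, ← Set.range_comp, rowLattice, Submodule.span_int_eq_addSubgroupClosure]
  congr 2
  funext v
  exact (coeffs_fPoly n d v).symm

theorem closure_fPoly :
    AddSubgroup.closure (fPoly n d '' {v | v ≠ 0}) = AddSubgroup.closure (Set.range (fPoly n d)) :=
  closure_image_ne_zero_eq _ (sum_fPoly n d)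

/-- Each row sums to zero. Conversely, `sandpileGroup` is finite, so its order carries any integer
vector of sum zero into the row lattice, and over `ℚ` one may divide by that order. -/
theorem mem_rationalRowLattice_laplacian (hd : 2 ≤ d) (y : ZMod n → ℤ) :
    y ∈ rationalRowLattice (deBruijnGraph n d).laplacian ↔ ∑ v, y v = 0 := by
  rw [mem_rationalRowLattice]
  constructor
  · intro h
    have hle : Submodule.span ℚ (Set.range fun (i j : ZMod n) =>
        ((deBruijnGraph n d).laplacian i j : ℚ)) ≤
        LinearMap.ker (∑ v : ZMod n, LinearMap.proj (R := ℚ) (φ := fun _ => ℚ) v) := by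
      rw [Submodule.span_le]
      rintro _ ⟨v, rfl⟩
      rw [SetLike.mem_coe, LinearMap.mem_ker, LinearMap.sum_apply]
      simp only [LinearMap.proj_apply]
      rw [← coeffs_fPoly, ← Int.cast_sum, (mem_range_coeffs n _).1 ⟨_, rfl⟩, Int.cast_zero]
    have h' := hle h
    rw [LinearMap.mem_ker, LinearMap.sum_apply] at h'
    simp only [LinearMap.proj_apply] at h'
    exact_mod_cast h'
  · intro h
    obtain ⟨a, rfl⟩ := (mem_range_coeffs n y).2 h
    have hfin : Finite (SandDune.toZMod n d).ker := by
      have := SandDune.finite n d hd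
      infer_instance
    have hfin : Finite (sandpileGroup n d) :=
      .of_equiv _ (SandDune.nonempty_sandpileGroup_addEquiv n d).some.symm.toEquiv
    have h0 : Nat.card (sandpileGroup n d) • (QuotientAddGroup.mk a : sandpileGroup n d) = 0 :=
      card_nsmul_eq_zero'
    rw [← QuotientAddGroup.mk_nsmul, QuotientAddGroup.eq_zero_iff, closure_fPoly] at h0
    have h1 : Nat.card (sandpileGroup n d) • coeffs n a ∈
        rowLattice (deBruijnGraph n d).laplacian := by
      rw [← Submodule.mem_toAddSubgroup, rowLattice_laplacian, ← map_nsmul]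
      exact ⟨_, h0, rfl⟩
    have h2 : rowLattice (deBruijnGraph n d).laplacian ≤
        rationalRowLattice (deBruijnGraph n d).laplacian := by
      rw [rowLattice, Submodule.span_le]
      rintro _ ⟨v, rfl⟩
      exact (mem_rationalRowLattice _ _).2 (Submodule.subset_span ⟨v, rfl⟩)
    have h3 := (mem_rationalRowLattice _ _).1 (h2 h1)
    have h4 : (Nat.card (sandpileGroup n d) : ℚ) ≠ 0 := Nat.cast_ne_zero.2 Nat.card_pos.ne'
    refine (Submodule.smul_mem_iff _ h4).1 ?_
    convert h3 using 1
    funext v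
    simp

theorem nonempty_criticalGroup_addEquiv (hd : 2 ≤ d) :
    Nonempty ((deBruijnGraph n d).criticalGroup ≃+ sandpileGroup n d) := by
  let φ : augGroup n →+ smithGroup (deBruijnGraph n d).laplacian :=
    (rowLattice (deBruijnGraph n d).laplacian).mkQ.toAddMonoidHom.comp (coeffs n)
  have hk : φ.ker = AddSubgroup.closure (fPoly n d '' {v | v ≠ 0}) := by
    have h0 : (rowLattice (deBruijnGraph n d).laplacian).mkQ.toAddMonoidHom.ker =
        (rowLattice (deBruijnGraph n d).laplacian).toAddSubgroup := by
      ext y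
      rw [AddMonoidHom.mem_ker, LinearMap.toAddMonoidHom_coe, Submodule.mkQ_apply,
        Submodule.Quotient.mk_eq_zero, Submodule.mem_toAddSubgroup]
    rw [← AddMonoidHom.comap_ker, h0, rowLattice_laplacian,
      AddSubgroup.comap_map_eq_self_of_injective (coeffs_injective n), closure_fPoly]
  have hr : φ.range = (smithFinitePart (deBruijnGraph n d).laplacian).toAddSubgroup := by
    ext y
    rw [Submodule.mem_toAddSubgroup, smithFinitePart, Submodule.mem_map]
    constructor
    · rintro ⟨a, rfl⟩
      exact ⟨_, (mem_rationalRowLattice_laplacian n d hd _).2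
        ((mem_range_coeffs n _).1 ⟨a, rfl⟩), rfl⟩
    · rintro ⟨z, hz, rfl⟩
      obtain ⟨a, rfl⟩ := (mem_range_coeffs n z).2 ((mem_rationalRowLattice_laplacian n d hd z).1 hz)
      exact ⟨a, rfl⟩
  exact ⟨(((QuotientAddGroup.quotientAddEquivOfEq hk.symm).trans
    (QuotientAddGroup.quotientKerEquivRange φ)).trans (AddEquiv.addSubgroupCongr hr)).symm⟩

end deBruijnGraph

end

noncomputable section

/-! ### Circulant matrices as elements of `𝔽_p[x] / (x^n - 1)` -/

open Polynomial in
/-- The ring `𝔽_p[x] / (x^n - 1)`. -/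
abbrev CyclicAlgebra (n p : ℕ) : Type := AdjoinRoot ((X : (ZMod p)[X]) ^ n - 1)

namespace CyclicAlgebra

open Polynomial Finset

variable (n p : ℕ)

/-- The class of `x`. -/
def x : CyclicAlgebra n p := AdjoinRoot.root _

theorem x_pow_self : x n p ^ n = 1 := root_X_pow_sub_one_pow_self n (ZMod p)

theorem x_pow_val (k : ℕ) : x n p ^ (k : ZMod n).val = x n p ^ k :=
  root_X_pow_sub_one_pow_val n (ZMod p) k

variable [Fact p.Prime]

theorem cyclicBasis_eq [NeZero n] (v : ZMod n) : cyclicBasis n (ZMod p) v = x n p ^ v.val :=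
  cyclicBasis_apply n (ZMod p) v

theorem cyclicBasis_natCast [NeZero n] (k : ℕ) : cyclicBasis n (ZMod p) k = x n p ^ k := by
  rw [cyclicBasis_eq, x_pow_val]

instance [NeZero n] : Finite (CyclicAlgebra n p) :=
  have := Module.Finite.of_basis (cyclicBasis n (ZMod p))
  Module.finite_of_finite (ZMod p)

theorem natCard [NeZero n] : Nat.card (CyclicAlgebra n p) = p ^ n := by
  rw [Nat.card_congr (cyclicBasis n (ZMod p)).equivFun.toEquiv, Nat.card_fun, Nat.card_zmod,
    Nat.card_zmod]

/-- The augmentation `a ↦ a(1)`. -/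
def aug : CyclicAlgebra n p →+* ZMod p := AdjoinRoot.lift (RingHom.id _) 1 (by simp)

theorem aug_x : aug n p (x n p) = 1 := by simp [aug, x]

theorem aug_algebraMap (c : ZMod p) : aug n p (algebraMap _ _ c) = c := by
  rw [AdjoinRoot.algebraMap_eq, aug, AdjoinRoot.lift_of, RingHom.id_apply]

/-- The circulant matrix of an element of `𝔽_p[x] / (x^n - 1)`. -/
def toMatrix : CyclicAlgebra n p →ₐ[ZMod p] Matrix (Fin n) (Fin n) (ZMod p) :=
  Ideal.Quotient.liftₐ _ (aeval (cycMatrix n (ZMod p))) fun a ha => by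
    obtain ⟨b, rfl⟩ := Ideal.mem_span_singleton.1 ha
    simp [cycMatrix_pow_self]

theorem toMatrix_x : toMatrix n p (x n p) = cycMatrix n (ZMod p) := by
  change aeval (cycMatrix n (ZMod p)) X = _
  rw [aeval_X]

theorem exists_toMatrix_eq {M : Matrix (Fin n) (Fin n) (ZMod p)} (hM : IsCirculant M) :
    ∃ a, toMatrix n p a = M := by
  obtain ⟨c, rfl⟩ := hM
  refine ⟨∑ i : Fin n, c i • x n p ^ ((i : ℕ) + 1), ?_⟩
  simp [toMatrix_x]

/-- The augmentation on units. -/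
def augUnits : (CyclicAlgebra n p)ˣ →* (ZMod p)ˣ := Units.map (aug n p : CyclicAlgebra n p →* _)

/-- The scalars as units. -/
def scalarUnits : (ZMod p)ˣ →* (CyclicAlgebra n p)ˣ :=
  Units.map (algebraMap (ZMod p) (CyclicAlgebra n p) : _ →* _)

theorem augUnits_scalarUnits (c : (ZMod p)ˣ) : augUnits n p (scalarUnits n p c) = c :=
  Units.ext (aug_algebraMap n p c)

variable [NeZero n]

theorem induction {P : CyclicAlgebra n p → Prop} (h0 : P 0) (hx : ∀ k, P (x n p ^ k))
    (ha : ∀ a b, P a → P b → P (a + b)) (hs : ∀ (c : ZMod p) a, P a → P (c • a))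
    (a : CyclicAlgebra n p) : P a := by
  induction (cyclicBasis n (ZMod p)).mem_span a using Submodule.span_induction with
  | mem a h =>
    obtain ⟨v, rfl⟩ := h
    rw [cyclicBasis_eq]
    exact hx _
  | zero => exact h0
  | add a b _ _ h h' => exact ha a b h h'
  | smul c a _ h => exact hs c a h

theorem toMatrix_mulVec_one (a : CyclicAlgebra n p) :
    (toMatrix n p a).mulVec 1 = aug n p a • (1 : Fin n → ZMod p) := by
  have hQ (k : ℕ) : (cycMatrix n (ZMod p) ^ k).mulVec 1 = 1 := by
    rw [cycMatrix, permMatrix_pow, Matrix.permMatrix_mulVec]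
    rfl
  induction a using induction n p with
  | h0 => simp
  | hx k => rw [map_pow, toMatrix_x, hQ, map_pow, aug_x, one_pow, one_smul]
  | ha a b ha hb => rw [map_add, Matrix.add_mulVec, ha, hb, map_add, add_smul]
  | hs c a ha =>
    rw [map_smul, Matrix.smul_mulVec, ha, Algebra.smul_def c a, map_mul, aug_algebraMap, mul_smul]

theorem isCirculant_toMatrix (a : CyclicAlgebra n p) : IsCirculant (toMatrix n p a) := by
  rw [isCirculant_iff_mem_span, ← (cyclicBasis n (ZMod p)).sum_repr a, map_sum]
  refine Submodule.sum_mem _ fun v _ => ?_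
  rw [map_smul, cyclicBasis_eq, map_pow, toMatrix_x]
  exact Submodule.smul_mem _ _ (isCirculant_iff_mem_span.1 (isCirculant_cycMatrix_pow _))

/-- Row `0` of `Q_n^k` has its one in the column `k` modulo `n`, so the first row of a circulant
matrix lists the coefficients. Injectivity of `toMatrix` follows. -/
theorem toMatrix_zero_apply (a : CyclicAlgebra n p) (j : Fin n) :
    toMatrix n p a 0 j = (cyclicBasis n (ZMod p)).repr a (j : ℕ) := by
  obtain ⟨m, rfl⟩ : ∃ m, n = m + 1 := Nat.exists_eq_succ_of_ne_zero (NeZero.ne n)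
  have hrot (k : ℕ) : ((finRotate (m + 1) ^ k) 0 : Fin (m + 1)) = Fin.ofNat (m + 1) k := by
    induction k with
    | zero => rfl
    | succ k ih =>
      rw [pow_succ', Equiv.Perm.mul_apply, ih, finRotate_apply]
      ext
      simp [Fin.val_add]
  have hM (k : ℕ) : (cycMatrix (m + 1) (ZMod p) ^ k) 0 j =
      if Fin.ofNat (m + 1) k = j then 1 else 0 := by
    rw [cycMatrix, permMatrix_pow]
    refine (PEquiv.toMatrix_apply _ _ _).trans ?_
    simp only [Equiv.toPEquiv_apply, Option.mem_some_iff, hrot]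
  induction a using induction (m + 1) p with
  | h0 => simp
  | hx k =>
    rw [map_pow, toMatrix_x, hM, ← cyclicBasis_natCast, Module.Basis.repr_self,
      Finsupp.single_apply]
    congr 1
    rw [eq_iff_iff, Fin.ext_iff, Fin.val_ofNat, ZMod.natCast_eq_natCast_iff', Nat.mod_eq_of_lt j.2]
  | ha a b ha hb => rw [map_add, Matrix.add_apply, ha, hb, map_add, Finsupp.add_apply]
  | hs c a ha => rw [map_smul, Matrix.smul_apply, ha, map_smul, Finsupp.smul_apply]

theorem toMatrix_injective : Function.Injective (toMatrix n p) := by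
  intro a b h
  refine (cyclicBasis n (ZMod p)).ext_elem fun v => ?_
  have h0 := toMatrix_zero_apply n p a ⟨v.val, ZMod.val_lt v⟩
  rw [h, toMatrix_zero_apply] at h0
  simpa only [ZMod.natCast_zmod_val] using h0.symm

/-- The isomorphism of the unit group of `𝔽_p[x] / (x^n - 1)` with the circulant group. -/
def circulantEquiv : (CyclicAlgebra n p)ˣ ≃* circulantGroup n p :=
  MulEquiv.ofBijective ((Units.map
    (toMatrix n p : CyclicAlgebra n p →* Matrix (Fin n) (Fin n) (ZMod p))).codRestrict
      (circulantGroup n p) fun u => isCirculant_toMatrix n p u) <| by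
    constructor
    · intro u v h
      exact Units.ext (toMatrix_injective n p
        (congrArg (fun g => (g.1 : Matrix (Fin n) (Fin n) (ZMod p))) h))
    · intro g
      obtain ⟨a, ha⟩ := exists_toMatrix_eq n p g.2
      -- The inverse is again circulant, so it also comes from the ring, and `a` is a unit there and
      -- not only as a matrix.
      obtain ⟨b, hb⟩ := exists_toMatrix_eq n p (g⁻¹).2
      have hab : a * b = 1 := toMatrix_injective n p (by
        rw [map_mul, ha, hb, map_one]
        exact Units.mul_inv g.1)
      exact ⟨⟨a, b, hab, mul_comm a b ▸ hab⟩, Subtype.ext (Units.ext ha)⟩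

/-- `x` as a unit. -/
def xUnit : (CyclicAlgebra n p)ˣ := Units.ofPowEqOne (x n p) n (x_pow_self n p) (NeZero.ne n)

theorem circulantEquiv_xUnit : circulantEquiv n p (xUnit n p) = cycUnit n p :=
  Subtype.ext (Units.ext (toMatrix_x n p))

theorem orderOf_xUnit : orderOf (xUnit n p) = n := by
  refine Nat.dvd_antisymm (orderOf_dvd_of_pow_eq_one (Units.ext (x_pow_self n p))) ?_
  have h : x n p ^ orderOf (xUnit n p) = 1 :=
    congrArg Units.val (pow_orderOf_eq_one (xUnit n p))
  rw [← pow_zero (x n p), ← cyclicBasis_natCast, ← cyclicBasis_natCast] at h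
  have h' := (cyclicBasis n (ZMod p)).injective h
  rwa [Nat.cast_zero, ZMod.natCast_eq_zero_iff] at h'

theorem xUnit_mem_ker : xUnit n p ∈ (augUnits n p).ker := Units.ext (aug_x n p)

/-- `x` as a unit of augmentation one. -/
def xUnitOne : (augUnits n p).ker := ⟨xUnit n p, xUnit_mem_ker n p⟩

theorem map_ker_augUnits :
    (augUnits n p).ker.map (circulantEquiv n p : _ →* circulantGroup n p) =
      circulantGroupOne n p := by
  ext g
  obtain ⟨u, rfl⟩ := (circulantEquiv n p).surjective g
  have h : circulantEquiv n p u ∈ (augUnits n p).ker.map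
      (circulantEquiv n p : _ →* circulantGroup n p) ↔ u ∈ (augUnits n p).ker :=
    Subgroup.mem_map_iff_mem (circulantEquiv n p).injective
  rw [h, MonoidHom.mem_ker]
  change _ ↔ (toMatrix n p u).mulVec 1 = 1
  rw [toMatrix_mulVec_one, Units.ext_iff]
  change aug n p u = 1 ↔ _
  constructor
  · intro h
    rw [h, one_smul]
  · intro h
    simpa using congrFun h 0

theorem map_scalarUnits :
    (scalarUnits n p).range.map (circulantEquiv n p : _ →* circulantGroup n p) =
      scalarSubgroup n p := by
  have h (c : (ZMod p)ˣ) : (circulantEquiv n p (scalarUnits n p c) : GL (Fin n) (ZMod p)) =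
      Matrix.GeneralLinearGroup.scalar (Fin n) c := by
    refine Units.ext ?_
    change toMatrix n p (algebraMap _ _ (c : ZMod p)) = Matrix.scalar (Fin n) (c : ZMod p)
    rw [AlgHom.commutes]
    rfl
  ext g
  rw [scalarSubgroup, Subgroup.mem_subgroupOf, Subgroup.mem_map]
  constructor
  · rintro ⟨_, ⟨c, rfl⟩, rfl⟩
    exact ⟨c, (h c).symm⟩
  · rintro ⟨c, hc⟩
    exact ⟨_, ⟨c, rfl⟩, Subtype.ext ((h c).trans hc)⟩

theorem map_sup_zpowers :
    ((scalarUnits n p).range ⊔ Subgroup.zpowers (xUnit n p)).map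
      (circulantEquiv n p : _ →* circulantGroup n p) = scalarCycSubgroup n p := by
  rw [Subgroup.map_sup, map_scalarUnits, MonoidHom.map_zpowers, scalarCycSubgroup]
  congr 2
  exact circulantEquiv_xUnit n p

/-- Units of augmentation one correspond to circulant matrices that fix the all-ones vector. -/
def circulantOneEquiv : (augUnits n p).ker ≃* circulantGroupOne n p :=
  ((circulantEquiv n p).subgroupMap _).trans (MulEquiv.subgroupCongr (map_ker_augUnits n p))

theorem circulantOneEquiv_xUnitOne : circulantOneEquiv n p (xUnitOne n p) = cycUnitOne n p :=
  Subtype.ext (circulantEquiv_xUnit n p)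

/-- The quotient version of `circulantOneEquiv`. -/
def circulantOneQuotientEquiv : (augUnits n p).ker ⧸ Subgroup.zpowers (xUnitOne n p) ≃*
    circulantGroupOne n p ⧸ Subgroup.zpowers (cycUnitOne n p) :=
  QuotientGroup.congr _ _ (circulantOneEquiv n p) (by
    rw [MonoidHom.map_zpowers]
    congr 1
    exact circulantOneEquiv_xUnitOne n p)

end CyclicAlgebra

/-! ### Quotients of a group with a retraction -/

section Retraction

variable {G F : Type*} [CommGroup G] [CommGroup F] {α : G →* F} {s : F →* G}

/-- The section `s` is injective, and its range meets the kernel of `α`, which contains `q`,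
trivially. The product is therefore direct. -/
theorem nonempty_sup_zpowers_mulEquiv (h : ∀ c, α (s c) = c) {q : G} (hq : q ∈ α.ker) :
    Nonempty (↥(s.range ⊔ Subgroup.zpowers q) ≃* F × Subgroup.zpowers q) := by
  let φ : F × Subgroup.zpowers q →* G := s.coprod (Subgroup.zpowers q).subtype
  have hφ : Function.Injective φ := by
    rw [injective_iff_map_eq_one]
    rintro ⟨c, z, hz⟩ h1
    replace h1 : s c * z = 1 := h1
    have hz' : α z = 1 := (Subgroup.zpowers_le.2 hq) hz
    have hc : c = 1 := by simpa [h, hz'] using congrArg α h1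
    rw [hc, map_one, one_mul] at h1
    exact Prod.ext hc (Subtype.ext h1)
  have hr : φ.range = s.range ⊔ Subgroup.zpowers q := by
    refine (MonoidHom.noncommCoprod_range s (Subgroup.zpowers q).subtype
      fun _ _ => Commute.all _ _).trans ?_
    rw [Subgroup.range_subtype]
  exact ⟨((MonoidHom.ofInjective hφ).trans (MulEquiv.subgroupCongr hr)).symm⟩

/-- Every `g` is `s (α g)` times an element of the kernel, so the kernel maps onto the quotient;
applying `α` shows that only powers of `q` are lost. -/
theorem nonempty_quotient_sup_zpowers_mulEquiv (h : ∀ c, α (s c) = c) {q : G}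
    (hq : q ∈ α.ker) :
    Nonempty (α.ker ⧸ Subgroup.zpowers (⟨q, hq⟩ : α.ker) ≃*
      G ⧸ (s.range ⊔ Subgroup.zpowers q)) := by
  let φ : α.ker →* G ⧸ (s.range ⊔ Subgroup.zpowers q) :=
    (QuotientGroup.mk' _).comp α.ker.subtype
  have hk : φ.ker = Subgroup.zpowers (⟨q, hq⟩ : α.ker) := by
    ext ⟨u, hu⟩
    rw [MonoidHom.mem_ker, MonoidHom.comp_apply, QuotientGroup.mk'_apply,
      QuotientGroup.eq_one_iff, Subgroup.mem_sup, Subgroup.mem_zpowers_iff]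
    constructor
    · rintro ⟨_, ⟨c, rfl⟩, z, hz, hzu⟩
      have hz' : α z = 1 := (Subgroup.zpowers_le.2 hq) hz
      obtain ⟨k, rfl⟩ := Subgroup.mem_zpowers_iff.1 hz
      have hc : c = 1 := by
        simpa [h, hz', MonoidHom.mem_ker.1 hu] using congrArg α hzu
      exact ⟨k, Subtype.ext (by simpa [hc] using hzu)⟩
    · rintro ⟨k, hk⟩
      exact ⟨1, one_mem _, q ^ k, ⟨k, rfl⟩, by simpa using congrArg Subtype.val hk⟩
  have hs : Function.Surjective φ := by
    intro g
    obtain ⟨g, rfl⟩ := QuotientGroup.mk_surjective g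
    refine ⟨⟨(s (α g))⁻¹ * g, by simp [MonoidHom.mem_ker, h]⟩, ?_⟩
    refine QuotientGroup.eq.2 ?_
    simp only [Subgroup.subtype_apply, mul_inv_rev, inv_inv, mul_assoc]
    rw [mul_comm, mul_assoc, mul_inv_cancel, mul_one]
    exact Subgroup.mem_sup_left ⟨_, rfl⟩
  exact ⟨(QuotientGroup.quotientMulEquivOfEq hk.symm).trans
    (QuotientGroup.quotientKerEquivOfSurjective φ hs)⟩

end Retraction

/-! ### The subgroup generated by the scalars and `Q_n` -/

namespace CyclicAlgebra

variable (n p : ℕ) [Fact p.Prime] [NeZero n]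

theorem nonempty_scalarCycSubgroup_mulEquiv :
    Nonempty (scalarCycSubgroup n p ≃* Multiplicative (ZMod (p - 1) × ZMod n)) := by
  obtain ⟨e⟩ := nonempty_sup_zpowers_mulEquiv (augUnits_scalarUnits n p) (xUnit_mem_ker n p)
  have e1 : (ZMod p)ˣ ≃* Multiplicative (ZMod (p - 1)) :=
    mulEquivOfCyclicCardEq (by
      rw [Nat.card_eq_fintype_card, ZMod.card_units]
      exact (Nat.card_zmod (p - 1)).symm)
  have e2 : Subgroup.zpowers (xUnit n p) ≃* Multiplicative (ZMod n) :=
    mulEquivOfCyclicCardEq (by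
      rw [Nat.card_zpowers, orderOf_xUnit]
      exact (Nat.card_zmod n).symm)
  exact ⟨((MulEquiv.subgroupCongr (map_sup_zpowers n p)).symm.trans
    (((circulantEquiv n p).subgroupMap _).symm.trans e)).trans
      ((e1.prodCongr e2).trans (MulEquiv.prodMultiplicative _ _).symm)⟩

theorem nonempty_quotient_scalarCycSubgroup_mulEquiv :
    Nonempty (circulantGroupOne n p ⧸ Subgroup.zpowers (cycUnitOne n p) ≃*
      circulantGroup n p ⧸ scalarCycSubgroup n p) := by
  obtain ⟨e⟩ := nonempty_quotient_sup_zpowers_mulEquiv (augUnits_scalarUnits n p)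
    (xUnit_mem_ker n p)
  exact ⟨(circulantOneQuotientEquiv n p).symm.trans
    (e.trans (QuotientGroup.congr _ _ (circulantEquiv n p) (map_sup_zpowers n p)))⟩

end CyclicAlgebra

end

noncomputable section

/-! ### The map `w ↦ d w` from `ℤ/m` to `ℤ/dm` -/

section mulEmb

variable (d m : ℕ)

/-- The injection `w ↦ d w` of `ℤ/m` into `ℤ/dm`. -/
def mulEmb (w : ZMod m) : ZMod (d * m) := (d * w.val : ℕ)

/-- The reduction `ℤ/dm → ℤ/m`. -/
def modMul : ZMod (d * m) →+* ZMod m := ZMod.castHom (dvd_mul_left m d) (ZMod m)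

theorem mulEmb_natCast (k : ℕ) : mulEmb d m k = (d * k : ℕ) := by
  rw [mulEmb, ZMod.val_natCast, ZMod.natCast_eq_natCast_iff', Nat.mul_mod_mul_left,
    Nat.mul_mod_mul_left, Nat.mod_mod]

theorem mulEmb_zero : mulEmb d m 0 = 0 := by simp [mulEmb]

variable [NeZero m]

theorem modMul_mulEmb (w : ZMod m) : modMul d m (mulEmb d m w) = d * w := by
  rw [mulEmb, map_natCast, Nat.cast_mul, ZMod.natCast_zmod_val]

theorem modMul_surjective : Function.Surjective (modMul d m) :=
  fun w => ⟨(w.val : ℕ), by rw [map_natCast, ZMod.natCast_zmod_val]⟩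

variable [NeZero d]

/-- Multiplication by `d` on `ℤ/dm` factors through `ℤ/m`. Both lemmas named `emb_reduce` lift this
factorization, one to sand dune groups and one to the rings. -/
theorem mulEmb_modMul (v : ZMod (d * m)) : mulEmb d m (modMul d m v) = d * v := by
  obtain ⟨k, rfl⟩ : ∃ k : ℕ, (k : ZMod (d * m)) = v := ⟨_, ZMod.natCast_zmod_val v⟩
  rw [map_natCast, mulEmb_natCast, Nat.cast_mul]

theorem mulEmb_injective : Function.Injective (mulEmb d m) := by
  intro w w' h
  rw [mulEmb, mulEmb, ZMod.natCast_eq_natCast_iff', Nat.mul_mod_mul_left,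
    Nat.mul_mod_mul_left] at h
  have h' := Nat.eq_of_mul_eq_mul_left (NeZero.pos d) h
  rw [← ZMod.natCast_eq_natCast_iff'] at h'
  rwa [ZMod.natCast_zmod_val, ZMod.natCast_zmod_val] at h'

theorem card_compl_range_mulEmb :
    Nat.card {v // v ∉ Set.range (mulEmb d m)} = d * m - m := by
  have h := Set.ncard_compl (Set.range (mulEmb d m))
  rw [Set.ncard_range_of_injective (mulEmb_injective d m), Nat.card_zmod, Nat.card_zmod] at h
  exact h

end mulEmb

/-! ### Reduction of sand dune groups -/

namespace SandDune

variable (d m : ℕ) [NeZero d] [NeZero m]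

/-- The reduction from level `dm` to level `m`. -/
def reduce : sandDuneGroup (d * m) d →+ sandDuneGroup m d :=
  lift (fun v => gen m d (modMul d m v)) fun v => by rw [map_mul, map_natCast, nsmul_gen]

theorem reduce_gen (v : ZMod (d * m)) : reduce d m (gen _ d v) = gen m d (modMul d m v) :=
  lift_gen _ _ (by rw [map_zero, gen_zero]) v

theorem reduce_surjective : Function.Surjective (reduce d m) := by
  intro σ
  induction σ using induction m d with
  | h0 => exact ⟨0, map_zero _⟩
  | hg w =>
    obtain ⟨v, rfl⟩ := modMul_surjective d m w
    exact ⟨_, reduce_gen d m v⟩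
  | ha a b ha hb =>
    obtain ⟨x, rfl⟩ := ha
    obtain ⟨y, rfl⟩ := hb
    exact ⟨x + y, map_add _ _ _⟩
  | hn a ha =>
    obtain ⟨x, rfl⟩ := ha
    exact ⟨-x, map_neg _ _⟩

/-- The embedding of level `m` into level `dm`. -/
def emb : sandDuneGroup m d →+ sandDuneGroup (d * m) d :=
  lift (fun w => gen (d * m) d (mulEmb d m w)) fun w => by
    rw [nsmul_gen, ← mulEmb_modMul, modMul_mulEmb]

theorem emb_gen (w : ZMod m) : emb d m (gen m d w) = gen _ d (mulEmb d m w) :=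
  lift_gen _ _ (by rw [mulEmb_zero, gen_zero]) w

theorem emb_reduce (σ : sandDuneGroup (d * m) d) : emb d m (reduce d m σ) = d • σ := by
  have h : (emb d m).comp (reduce d m) = nsmulAddMonoidHom d := by
    refine hom_ext _ _ fun v => ?_
    rw [AddMonoidHom.comp_apply, reduce_gen, emb_gen, mulEmb_modMul, nsmulAddMonoidHom_apply,
      nsmul_gen]
  exact DFunLike.congr_fun h σ

/-- Homomorphisms to a divisible group extend along `emb`. -/
theorem exists_comp_emb_eq {M : Type*} [AddCommGroup M] (hM : ∀ t : M, ∃ t', d • t' = t)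
    (χ : sandDuneGroup m d →+ M) : ∃ χ' : sandDuneGroup (d * m) d →+ M, χ'.comp (emb d m) = χ := by
  classical
  choose div hdiv using hM
  -- On the image of `mulEmb` the values are forced. At any other index `v` the only constraint is
  -- `d • u v = u (d v)`, with the right side already fixed, and divisibility solves it.
  let u : ZMod (d * m) → M := fun v =>
    if h : v ∈ Set.range (mulEmb d m) then χ (gen m d h.choose) else div (χ (gen m d (modMul d m v)))
  have hu (w : ZMod m) : u (mulEmb d m w) = χ (gen m d w) := by
    have h : mulEmb d m w ∈ Set.range (mulEmb d m) := ⟨w, rfl⟩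
    simp only [u, dif_pos h]
    rw [mulEmb_injective d m h.choose_spec]
  have h (v : ZMod (d * m)) : u (d * v) = d • u v := by
    rw [← mulEmb_modMul, hu]
    by_cases hv : v ∈ Set.range (mulEmb d m)
    · obtain ⟨w, rfl⟩ := hv
      rw [hu, modMul_mulEmb, ← nsmul_gen, map_nsmul]
    · simp only [u, dif_neg hv, hdiv]
  refine ⟨lift u h, ?_⟩
  refine hom_ext _ _ fun w => ?_
  rw [AddMonoidHom.comp_apply, emb_gen, lift_gen, hu]
  rw [← mulEmb_zero, hu, gen_zero, map_zero]

/-- Characters with values in `ℚ/ℤ` separate points, and each of them extends along `emb` because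
`ℚ/ℤ` is divisible. -/
theorem emb_injective : Function.Injective (emb d m) := by
  rw [injective_iff_map_eq_zero]
  intro σ hσ
  refine CharacterModule.eq_zero_of_character_apply fun χ => ?_
  obtain ⟨χ', h⟩ := exists_comp_emb_eq d m (M := AddCircle (1 : ℚ)) (fun t => by
    induction t using QuotientAddGroup.induction_on with
    | H q =>
      refine ⟨((q / d : ℚ) : AddCircle (1 : ℚ)), ?_⟩
      rw [← AddCircle.coe_nsmul, nsmul_eq_mul, mul_div_cancel₀ _ (NeZero.ne (d : ℚ))]) χ
  have h' := DFunLike.congr_fun h σ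
  rw [AddMonoidHom.comp_apply, hσ, map_zero] at h'
  exact h'.symm

theorem reduce_eq_zero_iff (σ : sandDuneGroup (d * m) d) : reduce d m σ = 0 ↔ d • σ = 0 := by
  rw [← emb_reduce, map_eq_zero_iff _ (emb_injective d m)]

theorem modMul_toZMod (σ : sandDuneGroup (d * m) d) :
    toZMod m d (reduce d m σ) = modMul d m (toZMod (d * m) d σ) := by
  have h : (toZMod m d).comp (reduce d m) =
      (modMul d m : ZMod (d * m) →+ ZMod m).comp (toZMod (d * m) d) := by
    refine hom_ext _ _ fun v => ?_
    simp [reduce_gen, toZMod_gen]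
  exact DFunLike.congr_fun h σ

/-- The reduction on the kernels of `toZMod`. -/
def reduceKer : (toZMod (d * m) d).ker →+ (toZMod m d).ker :=
  ((reduce d m).comp (AddSubgroup.subtype _)).codRestrict _ fun σ => by
    rw [AddMonoidHom.mem_ker, AddMonoidHom.comp_apply, modMul_toZMod]
    exact (congrArg _ σ.2).trans (map_zero _)

theorem reduceKer_eq_zero_iff (σ : (toZMod (d * m) d).ker) :
    reduceKer d m σ = 0 ↔ d • σ = 0 := by
  rw [Subtype.ext_iff, Subtype.ext_iff]
  exact reduce_eq_zero_iff d m σ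

theorem reduceKer_surjective : Function.Surjective (reduceKer d m) := by
  rintro ⟨τ, hτ⟩
  obtain ⟨σ, rfl⟩ := reduce_surjective d m τ
  rw [AddMonoidHom.mem_ker, modMul_toZMod] at hτ
  set v := toZMod (d * m) d σ with hv
  refine ⟨⟨σ - gen (d * m) d v, ?_⟩, Subtype.ext ?_⟩
  · rw [AddMonoidHom.mem_ker, map_sub, toZMod_gen, ← hv, sub_self]
  · change reduce d m (σ - gen (d * m) d v) = reduce d m σ
    rw [map_sub, reduce_gen, hτ, gen_zero, sub_zero]

/-! #### The order of the sand dune group -/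

open Classical in
/-- Coefficients modulo `d` at the residue classes that are not divisible by `d`. -/
def coeffMod : sandDuneGroup (d * m) d →+ ({v // v ∉ Set.range (mulEmb d m)} → ZMod d) :=
  lift (fun v t => if t.1 = v then 1 else 0) fun v => by
    funext t
    rw [Pi.smul_apply, nsmul_eq_mul, CharP.cast_eq_zero (ZMod d), zero_mul, if_neg]
    rintro h
    exact t.2 ⟨_, (mulEmb_modMul d m v).trans h.symm⟩

open Classical in
theorem coeffMod_gen (v : ZMod (d * m)) :
    coeffMod d m (gen _ d v) = fun t => if t.1 = v then 1 else 0 := by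
  refine lift_gen _ _ ?_ v
  funext t
  rw [Pi.zero_apply, if_neg]
  exact fun h => t.2 ⟨0, (mulEmb_zero d m).trans h.symm⟩

/-- The combination of generators with the given coefficients. -/
def ofCoeffs : ({v // v ∉ Set.range (mulEmb d m)} → ℤ) →+ sandDuneGroup (d * m) d :=
  have := Fintype.ofFinite {v // v ∉ Set.range (mulEmb d m)}
  ∑ t, ((zmultiplesHom _ (gen _ d t.1)).comp (Pi.evalAddMonoidHom _ t))

theorem coeffMod_ofCoeffs (c : {v // v ∉ Set.range (mulEmb d m)} → ℤ) :
    coeffMod d m (ofCoeffs d m c) = fun t => (c t : ZMod d) := by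
  classical
  funext t
  simp [ofCoeffs, coeffMod_gen, Finset.sum_apply, Subtype.coe_inj]

/-- A generator with index in the image of `mulEmb` is `d` times another generator, so the remaining
ones span modulo `d`. -/
theorem exists_sub_ofCoeffs_eq (σ : sandDuneGroup (d * m) d) :
    ∃ c τ, σ = ofCoeffs d m c + d • τ := by
  classical
  induction σ using induction (d * m) d with
  | h0 => exact ⟨0, 0, by simp⟩
  | hg v =>
    by_cases hv : v ∈ Set.range (mulEmb d m)
    · obtain ⟨w, rfl⟩ := hv
      obtain ⟨v, rfl⟩ := modMul_surjective d m w
      exact ⟨0, gen _ d v, by rw [map_zero, zero_add, nsmul_gen, mulEmb_modMul]⟩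
    · refine ⟨Pi.single ⟨v, hv⟩ 1, 0, ?_⟩
      simp [ofCoeffs, Pi.single_apply]
  | ha a b ha hb =>
    obtain ⟨c, τ, rfl⟩ := ha
    obtain ⟨c', τ', rfl⟩ := hb
    exact ⟨c + c', τ + τ', by rw [map_add, nsmul_add]; abel⟩
  | hn a ha =>
    obtain ⟨c, τ, rfl⟩ := ha
    exact ⟨-c, -τ, by rw [map_neg, neg_nsmul]; abel⟩

theorem coeffMod_surjective : Function.Surjective (coeffMod d m) := by
  intro f
  refine ⟨ofCoeffs d m fun t => (f t).val, ?_⟩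
  rw [coeffMod_ofCoeffs]
  funext t
  simp

/-- With `coeffMod_surjective` this identifies `Σ / dΣ` with a power of `ℤ/d` and so gives its
order. -/
theorem ker_coeffMod :
    (coeffMod d m).ker = (nsmulAddMonoidHom d : sandDuneGroup (d * m) d →+ _).range := by
  have h0 (f : {v // v ∉ Set.range (mulEmb d m)} → ZMod d) : d • f = 0 := by
    funext t
    simp
  apply le_antisymm
  · intro σ hσ
    obtain ⟨c, τ, rfl⟩ := exists_sub_ofCoeffs_eq d m σ
    rw [AddMonoidHom.mem_ker, map_add, map_nsmul, h0, add_zero, coeffMod_ofCoeffs] at hσ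
    have hc : ∀ t, ∃ b, c t = d * b := fun t =>
      (ZMod.intCast_zmod_eq_zero_iff_dvd _ _).1 (congrFun hσ t)
    choose b hb using hc
    have : c = d • b := by
      funext t
      simp [hb]
    exact ⟨ofCoeffs d m b + τ, by
      rw [this, map_nsmul, ← nsmul_add]
      rfl⟩
  · rintro _ ⟨τ, rfl⟩
    rw [AddMonoidHom.mem_ker, nsmulAddMonoidHom_apply, map_nsmul, h0]

end SandDune

theorem AddMonoidHom.natCard_eq_range_mul_ker {A B : Type*} [AddCommGroup A] [AddCommGroup B]
    (f : A →+ B) : Nat.card A = Nat.card f.range * Nat.card f.ker := by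
  rw [AddSubgroup.card_eq_card_quotient_mul_card_addSubgroup f.ker,
    Nat.card_congr (QuotientAddGroup.quotientKerEquivRange f).toEquiv]

theorem AddMonoidHom.natCard_eq_mul_ker {A B : Type*} [AddCommGroup A] [AddCommGroup B]
    (f : A →+ B) (hf : Function.Surjective f) : Nat.card A = Nat.card B * Nat.card f.ker := by
  rw [f.natCard_eq_range_mul_ker, AddMonoidHom.range_eq_top.2 hf, AddSubgroup.card_top]

namespace SandDune

variable (d m : ℕ) [NeZero d] [NeZero m]

/-- The kernel of `reduce` is the `d`-torsion, and in a finite abelian group this has as many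
elements as the quotient by the multiples of `d`. -/
theorem natCard_mul (hd : 2 ≤ d) :
    Nat.card (sandDuneGroup (d * m) d) = Nat.card (sandDuneGroup m d) * d ^ (d * m - m) := by
  have := finite (d * m) d hd
  have h1 := (coeffMod d m).natCard_eq_mul_ker (coeffMod_surjective d m)
  rw [ker_coeffMod, Nat.card_fun, Nat.card_zmod, card_compl_range_mulEmb,
    (nsmulAddMonoidHom d : sandDuneGroup (d * m) d →+ _).natCard_eq_range_mul_ker, mul_comm] at h1
  have h2 := Nat.eq_of_mul_eq_mul_right Nat.card_pos h1
  rw [(reduce d m).natCard_eq_mul_ker (reduce_surjective d m), ← h2]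
  congr 1
  exact Nat.card_congr (Equiv.subtypeEquivRight fun σ => reduce_eq_zero_iff d m σ)

theorem natCard_ker_toZMod (n d : ℕ) [NeZero n] :
    Nat.card (sandDuneGroup n d) = n * Nat.card (toZMod n d).ker := by
  rw [(toZMod n d).natCard_eq_mul_ker (toZMod_surjective n d), Nat.card_zmod]

end SandDune

end

noncomputable section

/-! ### Reduction of units -/

namespace CyclicAlgebra

open Polynomial

variable (n p m : ℕ)

/-- A homomorphism from `𝔽_p[x] / (x^n - 1)` is determined by an `n`-th root of unity. -/
def liftPow {n p : ℕ} {S : Type*} [CommRing S] [Algebra (ZMod p) S] (r : S) (h : r ^ n = 1) :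
    CyclicAlgebra n p →+* S :=
  AdjoinRoot.lift (algebraMap (ZMod p) S) r (by simp [h])

theorem liftPow_x {n p : ℕ} {S : Type*} [CommRing S] [Algebra (ZMod p) S] (r : S) (h : r ^ n = 1) :
    liftPow (p := p) r h (x n p) = r := AdjoinRoot.lift_root _

theorem ringHom_ext {n p : ℕ} {S : Type*} [CommRing S] {f g : CyclicAlgebra n p →+* S}
    (h : f (x n p) = g (x n p)) : f = g :=
  AdjoinRoot.ringHom_ext (Subsingleton.elim _ _) h

theorem map_algebraMap {n p : ℕ} {S : Type*} [CommRing S] [Algebra (ZMod p) S]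
    (f : CyclicAlgebra n p →+* S) (c : ZMod p) :
    f (algebraMap (ZMod p) (CyclicAlgebra n p) c) = algebraMap (ZMod p) S c :=
  DFunLike.congr_fun (Subsingleton.elim (f.comp (algebraMap (ZMod p) (CyclicAlgebra n p)))
    (algebraMap (ZMod p) S)) c

/-- The reduction from level `pm` to level `m`. -/
def reduce : CyclicAlgebra (p * m) p →+* CyclicAlgebra m p :=
  liftPow (x m p) (by rw [mul_comm, pow_mul, x_pow_self, one_pow])

theorem reduce_x : reduce p m (x _ p) = x m p := liftPow_x _ _

/-- The embedding of level `m` into level `pm`. -/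
def emb : CyclicAlgebra m p →+* CyclicAlgebra (p * m) p :=
  liftPow (x _ p ^ p) (by rw [← pow_mul, x_pow_self])

theorem emb_x : emb p m (x m p) = x _ p ^ p := liftPow_x _ _

variable [Fact p.Prime]

theorem mem_ker_augUnits {u : (CyclicAlgebra n p)ˣ} :
    u ∈ (augUnits n p).ker ↔ aug n p u = 1 := Units.ext_iff

theorem aug_reduce (a : CyclicAlgebra (p * m) p) : aug m p (reduce p m a) = aug _ p a := by
  have h : (aug m p).comp (reduce p m) = aug _ p :=
    ringHom_ext (by rw [RingHom.comp_apply, reduce_x, aug_x, aug_x])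
  exact DFunLike.congr_fun h a

variable [NeZero n]

instance : Nontrivial (CyclicAlgebra n p) := (aug n p).domain_nontrivial

instance : CharP (CyclicAlgebra n p) p :=
  charP_of_injective_ringHom (algebraMap (ZMod p) (CyclicAlgebra n p)).injective p

/-- In characteristic `p` the Frobenius is a ring homomorphism, and it takes `x` to `x^p` as the
composite does. -/
theorem emb_reduce (a : CyclicAlgebra (p * m) p) : emb p m (reduce p m a) = a ^ p := by
  have : NeZero p := ⟨(Fact.out : p.Prime).ne_zero⟩
  have h : (emb p m).comp (reduce p m) = frobenius _ p :=
    ringHom_ext (by rw [RingHom.comp_apply, reduce_x, emb_x, frobenius_def])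
  exact DFunLike.congr_fun h a

variable [NeZero m]

theorem emb_eq_sum [NeZero p] (a : CyclicAlgebra m p) :
    emb p m a = ∑ w, (cyclicBasis m (ZMod p)).repr a w •
      cyclicBasis (p * m) (ZMod p) (mulEmb p m w) := by
  conv_lhs => rw [← (cyclicBasis m (ZMod p)).sum_repr a]
  rw [map_sum]
  refine Finset.sum_congr rfl fun w _ => ?_
  rw [Algebra.smul_def, Algebra.smul_def, map_mul, cyclicBasis_eq, map_pow, emb_x, mulEmb,
    cyclicBasis_natCast, ← pow_mul]
  congr 1
  exact map_algebraMap _ _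

theorem emb_injective : Function.Injective (emb p m) := by
  have : NeZero p := ⟨(Fact.out : p.Prime).ne_zero⟩
  rw [injective_iff_map_eq_zero]
  intro a ha
  rw [emb_eq_sum] at ha
  refine (cyclicBasis m (ZMod p)).ext_elem fun w => ?_
  rw [map_zero, Finsupp.zero_apply]
  exact Fintype.linearIndependent_iff.1 ((cyclicBasis (p * m) (ZMod p)).linearIndependent.comp _
    (mulEmb_injective p m)) _ ha w

theorem reduce_eq_one_iff (a : CyclicAlgebra (p * m) p) : reduce p m a = 1 ↔ a ^ p = 1 := by
  rw [← emb_reduce, map_eq_one_iff _ (emb_injective p m)]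

theorem reduce_surjective : Function.Surjective (reduce p m) := by
  intro a
  induction a using induction m p with
  | h0 => exact ⟨0, map_zero _⟩
  | hx k => exact ⟨x _ p ^ k, by rw [map_pow, reduce_x]⟩
  | ha a b ha hb =>
    obtain ⟨a, rfl⟩ := ha
    obtain ⟨b, rfl⟩ := hb
    exact ⟨a + b, map_add _ _ _⟩
  | hs c a ha =>
    obtain ⟨a, rfl⟩ := ha
    refine ⟨algebraMap _ _ c * a, ?_⟩
    rw [Algebra.smul_def, map_mul]
    congr 1
    exact map_algebraMap _ c

/-- If `a b` reduces to `1`, then `(a b)^p = 1`, so `a` is invertible. -/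
theorem isUnit_of_isUnit_reduce {a : CyclicAlgebra (p * m) p} (h : IsUnit (reduce p m a)) :
    IsUnit a := by
  obtain ⟨b, hb⟩ := h.exists_right_inv
  obtain ⟨b, rfl⟩ := reduce_surjective p m b
  rw [← map_mul, reduce_eq_one_iff] at hb
  exact isUnit_of_mul_isUnit_left
    (IsUnit.of_pow_eq_one hb (Fact.out : p.Prime).ne_zero)

/-- The reduction of the units of augmentation one. -/
def reduceUnits : (augUnits (p * m) p).ker →* (augUnits m p).ker :=
  ((Units.map (reduce p m : CyclicAlgebra (p * m) p →* CyclicAlgebra m p)).comp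
    (Subgroup.subtype _)).codRestrict _
    fun u => (Units.ext_iff.2 ((aug_reduce p m _).trans (Units.ext_iff.1 u.2)))

theorem reduceUnits_eq_one_iff (u : (augUnits (p * m) p).ker) :
    reduceUnits p m u = 1 ↔ u ^ p = 1 := by
  rw [Subtype.ext_iff, Subtype.ext_iff, Units.ext_iff, Units.ext_iff]
  exact reduce_eq_one_iff p m u.1

theorem reduceUnits_surjective : Function.Surjective (reduceUnits p m) := by
  rintro ⟨u, hu⟩
  obtain ⟨a, ha⟩ := reduce_surjective p m u
  obtain ⟨v, rfl⟩ := isUnit_of_isUnit_reduce p m (ha ▸ u.isUnit)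
  refine ⟨⟨v, Units.ext ?_⟩, Subtype.ext (Units.ext ha)⟩
  exact (aug_reduce p m v).symm.trans ((congrArg _ ha).trans (Units.ext_iff.1 hu))

/-- The kernel of `reduceUnits` is `1 + a` with `a` in the kernel of the ring reduction, all such
elements being units of augmentation one. The latter kernel has `p^(pm) / p^m` elements. -/
theorem natCard_ker_augUnits_mul : Nat.card (augUnits (p * m) p).ker =
    Nat.card (augUnits m p).ker * p ^ (p * m - m) := by
  have hp : p.Prime := Fact.out
  have : NeZero p := ⟨hp.ne_zero⟩
  have h1 := (reduce p m : CyclicAlgebra (p * m) p →+ CyclicAlgebra m p).natCard_eq_mul_ker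
    (reduce_surjective p m)
  rw [natCard, natCard] at h1
  have h2 : Nat.card (reduceUnits p m).ker =
      Nat.card (reduce p m : CyclicAlgebra (p * m) p →+ CyclicAlgebra m p).ker := by
    refine Nat.card_congr (Equiv.ofBijective (fun u => ⟨(u.1.1 : CyclicAlgebra (p * m) p) - 1, ?_⟩)
      ⟨?_, ?_⟩)
    · have h : reduce p m u.1.1 = 1 := Units.ext_iff.1 (Subtype.ext_iff.1 u.2)
      change reduce p m _ = 0
      rw [map_sub, h, map_one, sub_self]
    · intro u v h
      exact Subtype.ext (Subtype.ext (Units.ext (sub_left_injective (Subtype.ext_iff.1 h))))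
    · rintro ⟨a, ha⟩
      replace ha : reduce p m a = 0 := ha
      have h : reduce p m (a + 1) = 1 := by rw [map_add, ha, map_one, zero_add]
      obtain ⟨u, hu⟩ := isUnit_of_isUnit_reduce p m (a := a + 1) (h ▸ isUnit_one)
      refine ⟨⟨⟨u, (mem_ker_augUnits (p * m) p).2 ?_⟩, Subtype.ext (Units.ext (hu ▸ h))⟩,
        Subtype.ext ?_⟩
      · rw [← aug_reduce, hu, h, map_one]
      · change (u : CyclicAlgebra (p * m) p) - 1 = a
        rw [hu, add_sub_cancel_right]
  rw [Subgroup.card_eq_card_quotient_mul_card_subgroup (reduceUnits p m).ker, h2,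
    Nat.card_congr (QuotientGroup.quotientKerEquivOfSurjective _
      (reduceUnits_surjective p m)).toEquiv]
  congr 1
  refine Nat.eq_of_mul_eq_mul_left (pow_pos hp.pos m) ?_
  rw [← h1, ← pow_add, Nat.add_sub_cancel' (Nat.le_mul_of_pos_left m hp.pos)]

theorem orderOf_xUnitOne : orderOf (xUnitOne n p) = n :=
  (Subgroup.orderOf_coe (xUnitOne n p)).symm.trans (orderOf_xUnit n p)

theorem natCard_ker_augUnits : Nat.card (augUnits n p).ker =
    n * Nat.card ((augUnits n p).ker ⧸ Subgroup.zpowers (xUnitOne n p)) := by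
  rw [Subgroup.card_eq_card_quotient_mul_card_subgroup (Subgroup.zpowers (xUnitOne n p)),
    Nat.card_zpowers, orderOf_xUnitOne, mul_comm]

theorem reduceUnits_xUnitOne : reduceUnits p m (xUnitOne _ p) = xUnitOne m p :=
  Subtype.ext (Units.ext (reduce_x p m))

/-- The reduction modulo the powers of `x`. -/
def reduceQuotient : (augUnits (p * m) p).ker ⧸ Subgroup.zpowers (xUnitOne (p * m) p) →*
    (augUnits m p).ker ⧸ Subgroup.zpowers (xUnitOne m p) :=
  QuotientGroup.map _ _ (reduceUnits p m) (by
    rw [Subgroup.zpowers_le, Subgroup.mem_comap, reduceUnits_xUnitOne]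
    exact Subgroup.mem_zpowers _)

theorem reduceQuotient_surjective : Function.Surjective (reduceQuotient p m) := by
  intro u
  obtain ⟨u, rfl⟩ := QuotientGroup.mk_surjective u
  obtain ⟨u, rfl⟩ := reduceUnits_surjective p m u
  exact ⟨QuotientGroup.mk u, rfl⟩

/-- The image of `emb` is spanned by the basis elements whose index lies in the image of `mulEmb`.
-/
theorem exists_mulEmb_eq_of_emb_eq [NeZero p] {a : CyclicAlgebra m p} {v : ZMod (p * m)}
    (h : emb p m a = cyclicBasis (p * m) (ZMod p) v) : ∃ w, mulEmb p m w = v := by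
  by_contra! hv
  have h1 := congrArg (fun b => (cyclicBasis (p * m) (ZMod p)).repr b v) h
  simp only [Module.Basis.repr_self, Finsupp.single_eq_same, emb_eq_sum, map_sum, map_smul,
    Finsupp.coe_finsetSum, Finset.sum_apply, Finsupp.smul_apply] at h1
  rw [Finset.sum_eq_zero] at h1
  · exact zero_ne_one h1
  · intro w _
    rw [Finsupp.single_eq_of_ne (hv w).symm, smul_zero]

theorem reduceQuotient_eq_one_iff
    (u : (augUnits (p * m) p).ker ⧸ Subgroup.zpowers (xUnitOne (p * m) p)) :
    reduceQuotient p m u = 1 ↔ u ^ p = 1 := by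
  have : NeZero p := ⟨(Fact.out : p.Prime).ne_zero⟩
  obtain ⟨u, rfl⟩ := QuotientGroup.mk_surjective u
  rw [reduceQuotient, QuotientGroup.map_mk, QuotientGroup.eq_one_iff, ← QuotientGroup.mk_pow,
    QuotientGroup.eq_one_iff]
  constructor
  · intro h
    obtain ⟨k, hk⟩ := Subgroup.mem_zpowers_iff.1 h
    rw [← reduceUnits_xUnitOne, ← map_zpow] at hk
    have h1 : reduceUnits p m (u * (xUnitOne _ p ^ k)⁻¹) = 1 := by
      rw [map_mul, map_inv, hk, mul_inv_cancel]
    rw [reduceUnits_eq_one_iff, mul_pow, inv_pow, mul_inv_eq_one] at h1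
    rw [h1]
    exact pow_mem (zpow_mem (Subgroup.mem_zpowers _) _) _
  · intro h
    -- From `u^p = x^k` and `u^p = emb (reduce u)`, the exponent `k` is `p w` modulo `pm`. So `emb`
    -- takes `reduce u` and `x^w` to the same element, and they are equal.
    have hf : Finite (augUnits (p * m) p).ker := inferInstance
    obtain ⟨k, hk⟩ := (isOfFinOrder_of_finite (xUnitOne (p * m) p)).mem_powers_iff_mem_zpowers.2 h
    have hk' : x (p * m) p ^ k = (u : (CyclicAlgebra (p * m) p)ˣ) ^ p :=
      congrArg (fun z : (augUnits (p * m) p).ker => (z.1 : CyclicAlgebra (p * m) p)) hk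
    rw [← emb_reduce, ← cyclicBasis_natCast] at hk'
    obtain ⟨w, hw⟩ := exists_mulEmb_eq_of_emb_eq p m hk'.symm
    rw [← hw, mulEmb, cyclicBasis_natCast, pow_mul, ← emb_x, ← map_pow] at hk'
    have h2 : xUnitOne m p ^ w.val = reduceUnits p m u :=
      Subtype.ext (Units.ext (emb_injective p m hk'))
    rw [← h2]
    exact pow_mem (Subgroup.mem_zpowers _) _

end CyclicAlgebra

end

noncomputable section

/-! ### Evaluation at roots of unity -/

/-- The polynomial `X^p - X` has at most `p` roots, and the elements of `𝔽_p` already supply `p` of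
them. -/
theorem mem_range_algebraMap_of_pow_eq {p : ℕ} [Fact p.Prime] {K : Type*} [Field K]
    [Algebra (ZMod p) K] {c : K} (hc : c ^ p = c) : c ∈ Set.range (algebraMap (ZMod p) K) := by
  classical
  by_contra h
  have hp : 1 < p := (Fact.out : p.Prime).one_lt
  have hP := FiniteField.X_pow_card_sub_X_ne_zero K hp
  let S : Finset K := insert c (Finset.univ.image (algebraMap (ZMod p) K))
  have hS : S.card = p + 1 := by
    rw [Finset.card_insert_of_notMem (by simpa using h),
      Finset.card_image_of_injective _ (algebraMap (ZMod p) K).injective, Finset.card_univ,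
      ZMod.card]
  have hle : S.val ≤ (Polynomial.X ^ p - Polynomial.X : Polynomial K).roots := by
    rw [Finset.val_le_iff_val_subset]
    intro x hx
    rw [Polynomial.mem_roots hP]
    rcases Finset.mem_insert.1 hx with rfl | hx
    · simp [hc]
    · obtain ⟨a, -, rfl⟩ := Finset.mem_image.1 hx
      simp [← map_pow, ZMod.pow_card]
  have h1 := (Multiset.card_le_card hle).trans (Polynomial.card_roots' _)
  rw [FiniteField.X_pow_card_sub_X_natDegree_eq K hp, Finset.card_val, hS] at h1
  omega

namespace CyclicAlgebra

open Polynomial Finset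

variable {n p : ℕ} {K : Type*} [Field K] [Algebra (ZMod p) K] {ζ : K}

theorem pow_val_natCast (hζ : IsPrimitiveRoot ζ n) (k : ℕ) : ζ ^ (k : ZMod n).val = ζ ^ k := by
  rw [ZMod.val_natCast]
  conv_rhs => rw [← Nat.div_add_mod k n, pow_add, pow_mul, hζ.pow_eq_one, one_pow, one_mul]

/-- Evaluation at `ζ ^ v`. -/
def evalPow (hζ : IsPrimitiveRoot ζ n) (v : ZMod n) : CyclicAlgebra n p →+* K :=
  liftPow (ζ ^ v.val) (by rw [← pow_mul, mul_comm, pow_mul, hζ.pow_eq_one, one_pow])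

theorem evalPow_x (hζ : IsPrimitiveRoot ζ n) (v : ZMod n) :
    evalPow hζ v (x n p) = ζ ^ v.val := liftPow_x _ _

theorem evalPow_mk (hζ : IsPrimitiveRoot ζ n) (v : ZMod n) (P : (ZMod p)[X]) :
    evalPow hζ v (AdjoinRoot.mk _ P) = (P.map (algebraMap (ZMod p) K)).eval (ζ ^ v.val) := by
  rw [evalPow, liftPow, AdjoinRoot.lift_mk, eval₂_eq_eval_map]

theorem evalPow_zero [Fact p.Prime] (hζ : IsPrimitiveRoot ζ n) (a : CyclicAlgebra n p) :
    evalPow hζ 0 a = algebraMap (ZMod p) K (aug n p a) := by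
  have h : evalPow hζ 0 = (algebraMap (ZMod p) K).comp (aug n p) :=
    ringHom_ext (by rw [evalPow_x, RingHom.comp_apply, aug_x, ZMod.val_zero, pow_zero, map_one])
  exact DFunLike.congr_fun h a

variable [NeZero n]

theorem pow_val_mul (hζ : IsPrimitiveRoot ζ n) (k : ℕ) (v : ZMod n) :
    ζ ^ ((k : ZMod n) * v).val = (ζ ^ v.val) ^ k := by
  obtain ⟨l, rfl⟩ : ∃ l : ℕ, (l : ZMod n) = v := ⟨_, ZMod.natCast_zmod_val v⟩
  rw [← Nat.cast_mul, pow_val_natCast hζ, pow_val_natCast hζ, mul_comm, pow_mul]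

theorem pow_val_injective (hζ : IsPrimitiveRoot ζ n) :
    Function.Injective fun v : ZMod n => ζ ^ v.val :=
  fun v w h => ZMod.val_injective n (hζ.pow_inj (ZMod.val_lt v) (ZMod.val_lt w) h)

variable [Fact p.Prime]

/-- Frobenius fixes the coefficients. This is the multiplicative form of `nsmul_gen`, which makes
values of units into characters. -/
theorem evalPow_mul (hζ : IsPrimitiveRoot ζ n) (v : ZMod n) (a : CyclicAlgebra n p) :
    evalPow hζ (p * v) a = evalPow hζ v a ^ p := by
  have : CharP K p := charP_of_injective_algebraMap (algebraMap (ZMod p) K).injective p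
  have h : evalPow hζ (p * v) = (frobenius K p).comp (evalPow (p := p) hζ v) :=
    ringHom_ext (by
      rw [evalPow_x, RingHom.comp_apply, evalPow_x, frobenius_def, pow_val_mul hζ])
  exact DFunLike.congr_fun h a

/-- The difference has a representative of degree below `n` that vanishes at the `n` distinct points
`ζ^v`. -/
theorem eq_of_evalPow_eq (hζ : IsPrimitiveRoot ζ n) {a b : CyclicAlgebra n p}
    (h : ∀ v, evalPow hζ v a = evalPow hζ v b) : a = b := by
  rw [← sub_eq_zero]
  have h' : ∀ v, evalPow hζ v (a - b) = 0 := fun v => by rw [map_sub, h, sub_self]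
  have hm : ((X : (ZMod p)[X]) ^ n - 1).Monic := monic_X_pow_sub_C 1 (NeZero.ne n)
  have hd : ((X : (ZMod p)[X]) ^ n - 1).degree = n := degree_X_pow_sub_C (NeZero.pos n) 1
  set P := AdjoinRoot.modByMonicHom hm (a - b) with hP
  have hab : AdjoinRoot.mk _ P = a - b := AdjoinRoot.mk_leftInverse hm _
  have hdeg : P.degree < n := by
    obtain ⟨R, hR⟩ := AdjoinRoot.mk_surjective (a - b)
    rw [hP, ← hR, AdjoinRoot.modByMonicHom_mk, ← hd]
    exact degree_modByMonic_lt _ hm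
  have h0 : P.map (algebraMap (ZMod p) K) = 0 := by
    refine eq_zero_of_degree_lt_of_eval_index_eq_zero (s := univ)
      (v := fun v : ZMod n => ζ ^ v.val) (pow_val_injective hζ).injOn ?_ fun v _ => ?_
    · rwa [degree_map, card_univ, ZMod.card]
    · rw [← evalPow_mk hζ, hab, h']
  rw [Polynomial.map_eq_zero] at h0
  rw [← hab, h0, map_zero]

/-- Interpolate `w` over `K`. As `v ↦ p v` permutes `ℤ/n`, the polynomial with coefficients raised
to the `p`-th power takes the same values, so the coefficients are fixed by Frobenius and lie in
`𝔽_p`. -/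
theorem exists_evalPow_eq (hζ : IsPrimitiveRoot ζ n) (hpn : p.Coprime n) (w : ZMod n → K)
    (hw : ∀ v, w (p * v) = w v ^ p) : ∃ a : CyclicAlgebra n p, ∀ v, evalPow hζ v a = w v := by
  have : CharP K p := charP_of_injective_algebraMap (algebraMap (ZMod p) K).injective p
  have hinj := (pow_val_injective hζ).injOn (s := ((univ : Finset (ZMod n)) : Set (ZMod n)))
  set P := Lagrange.interpolate univ (fun v : ZMod n => ζ ^ v.val) w with hP
  have hdeg : P.degree < #(univ : Finset (ZMod n)) := Lagrange.degree_interpolate_lt _ hinj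
  have heval (v : ZMod n) : P.eval (ζ ^ v.val) = w v :=
    Lagrange.eval_interpolate_at_node _ hinj (mem_univ v)
  have hPP : P.map (frobenius K p) = P := by
    refine eq_of_degrees_lt_of_eval_index_eq univ hinj ?_ hdeg fun v _ => ?_
    · rwa [degree_map]
    · obtain ⟨v, rfl⟩ : ∃ v', (p : ZMod n) * v' = v :=
        ⟨(p : ZMod n)⁻¹ * v, by rw [← mul_assoc, ZMod.coe_mul_inv_eq_one p hpn, one_mul]⟩
      rw [heval, hw, pow_val_mul hζ, ← frobenius_def, eval_map, eval₂_at_apply, heval,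
        frobenius_def]
  obtain ⟨R, hR⟩ : P ∈ lifts (algebraMap (ZMod p) K) := by
    rw [lifts_iff_coeff_lifts]
    intro k
    refine mem_range_algebraMap_of_pow_eq ?_
    conv_rhs => rw [← hPP]
    rw [coeff_map, frobenius_def]
  rw [coe_mapRingHom] at hR
  exact ⟨AdjoinRoot.mk _ R, fun v => by rw [evalPow_mk, hR, heval]⟩

end CyclicAlgebra

/-! ### Characters of the sand dune group -/

namespace SandDune

variable {n p : ℕ} [NeZero n]

theorem character_ext {M : Type*} [CommGroup M] {φ ψ : Multiplicative (sandDuneGroup n p) →* M}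
    (h : ∀ v, φ (.ofAdd (gen n p v)) = ψ (.ofAdd (gen n p v))) : φ = ψ :=
  AddMonoidHom.toMultiplicativeLeft.symm.injective (hom_ext n p fun v => congrArg Additive.ofMul (h v))

/-- The character that takes `gen v` to `w v`. -/
def character {M : Type*} [CommGroup M] (w : ZMod n → M) (hw : ∀ v, w (p * v) = w v ^ p) :
    Multiplicative (sandDuneGroup n p) →* M :=
  AddMonoidHom.toMultiplicativeLeft
    (lift (d := p) (fun v => Additive.ofMul (w v)) fun v => congrArg Additive.ofMul (hw v))

theorem character_gen {M : Type*} [CommGroup M] (w : ZMod n → M)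
    (hw : ∀ v, w (p * v) = w v ^ p) (h0 : w 0 = 1) (v : ZMod n) :
    character w hw (.ofAdd (gen n p v)) = w v :=
  congrArg Additive.toMul (lift_gen (d := p) (fun v => Additive.ofMul (w v))
    (fun v => congrArg Additive.ofMul (hw v)) (congrArg Additive.ofMul h0) v)

theorem apply_gen_mul {M : Type*} [CommGroup M]
    (φ : Multiplicative (sandDuneGroup n p) →* M) (v : ZMod n) :
    φ (.ofAdd (gen n p (p * v))) = φ (.ofAdd (gen n p v)) ^ p := by
  rw [← nsmul_gen, ofAdd_nsmul, map_pow]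

end SandDune

/-! ### Units as characters, and the case of `n` prime to `p` -/

namespace CyclicAlgebra

open SandDune

variable {n p : ℕ} [Fact p.Prime] {K : Type*} [Field K] [Algebra (ZMod p) K] {ζ : K}

/-- The value at `ζ ^ v` of a unit of augmentation one. -/
def evalUnit (hζ : IsPrimitiveRoot ζ n) (u : (augUnits n p).ker) (v : ZMod n) : Kˣ :=
  Units.map (evalPow (p := p) hζ v : CyclicAlgebra n p →* K) u

theorem coe_evalUnit (hζ : IsPrimitiveRoot ζ n) (u : (augUnits n p).ker) (v : ZMod n) :
    (evalUnit hζ u v : K) = evalPow hζ v (u.1 : CyclicAlgebra n p) := rfl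

theorem evalUnit_zero (hζ : IsPrimitiveRoot ζ n) (u : (augUnits n p).ker) :
    evalUnit hζ u 0 = 1 := by
  rw [Units.ext_iff, coe_evalUnit, evalPow_zero, (mem_ker_augUnits n p).1 u.2, map_one,
    Units.val_one]

variable [NeZero n]

theorem evalUnit_mul (hζ : IsPrimitiveRoot ζ n) (u : (augUnits n p).ker) (v : ZMod n) :
    evalUnit hζ u (p * v) = evalUnit hζ u v ^ p := Units.ext (evalPow_mul hζ v _)

/-- Units of augmentation one as characters of the sand dune group. -/
def toCharacter (hζ : IsPrimitiveRoot ζ n) :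
    (augUnits n p).ker →* (Multiplicative (sandDuneGroup n p) →* Kˣ) :=
  MonoidHom.mk' (fun u => character (evalUnit hζ u) (evalUnit_mul hζ u)) fun u u' =>
    character_ext fun v => by
      rw [MonoidHom.mul_apply, character_gen _ _ (evalUnit_zero hζ _),
        character_gen _ _ (evalUnit_zero hζ _), character_gen _ _ (evalUnit_zero hζ _)]
      exact map_mul _ _ _

theorem toCharacter_gen (hζ : IsPrimitiveRoot ζ n) (u : (augUnits n p).ker) (v : ZMod n) :
    (toCharacter hζ u (.ofAdd (gen n p v)) : K) = evalPow hζ v (u.1 : CyclicAlgebra n p) :=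
  congrArg Units.val (character_gen _ (evalUnit_mul hζ u) (evalUnit_zero hζ u) v)

theorem toCharacter_injective (hζ : IsPrimitiveRoot ζ n) :
    Function.Injective (toCharacter (p := p) hζ) := by
  intro u u' h
  refine Subtype.ext (Units.ext (eq_of_evalPow_eq hζ fun v => ?_))
  rw [← toCharacter_gen, h, toCharacter_gen]

theorem toCharacter_surjective (hζ : IsPrimitiveRoot ζ n) (hpn : p.Coprime n) :
    Function.Surjective (toCharacter (p := p) hζ) := by
  intro φ
  obtain ⟨a, ha⟩ := exists_evalPow_eq hζ hpn (fun v => (φ (.ofAdd (gen n p v)) : K)) fun v => by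
    rw [apply_gen_mul, Units.val_pow_eq_pow_val]
  -- Interpolating the inverse character produces the inverse of `a`.
  obtain ⟨b, hb⟩ := exists_evalPow_eq hζ hpn (fun v => (φ⁻¹ (.ofAdd (gen n p v)) : K)) fun v => by
    rw [apply_gen_mul, Units.val_pow_eq_pow_val]
  have hab : a * b = 1 := eq_of_evalPow_eq hζ fun v => by
    rw [map_mul, ha, hb, ← Units.val_mul, MonoidHom.inv_apply, mul_inv_cancel, Units.val_one,
      map_one]
  let u : (CyclicAlgebra n p)ˣ := ⟨a, b, hab, mul_comm a b ▸ hab⟩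
  have hu : u ∈ (augUnits n p).ker := by
    rw [mem_ker_augUnits]
    apply (algebraMap (ZMod p) K).injective
    rw [← evalPow_zero hζ, map_one]
    refine (ha 0).trans ?_
    rw [gen_zero, ofAdd_zero, map_one, Units.val_one]
  exact ⟨⟨u, hu⟩, character_ext fun v => Units.ext ((toCharacter_gen hζ _ v).trans (ha v))⟩

theorem toCharacter_xUnitOne_gen (hζ : IsPrimitiveRoot ζ n) (v : ZMod n) :
    (toCharacter hζ (xUnitOne n p) (.ofAdd (gen n p v)) : K) = ζ ^ v.val :=
  (toCharacter_gen hζ _ v).trans (evalPow_x hζ v)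

/-- The character of `x` factors through `toZMod`. The integer `m` is a lift of the image in `ℤ/n`,
so that `ζ ^ m` is meaningful. -/
theorem exists_toCharacter_xUnitOne_eq (hζ : IsPrimitiveRoot ζ n) (σ : sandDuneGroup n p) :
    ∃ m : ℤ, (m : ZMod n) = toZMod n p σ ∧
      (toCharacter hζ (xUnitOne n p) (.ofAdd σ) : K) = ζ ^ m := by
  have h0 : ζ ≠ 0 := hζ.ne_zero (NeZero.ne n)
  induction σ using SandDune.induction n p with
  | h0 => exact ⟨0, by simp⟩
  | hg v => exact ⟨v.val, by simp [toZMod_gen], by rw [toCharacter_xUnitOne_gen, zpow_natCast]⟩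
  | ha a b ha hb =>
    obtain ⟨m, hm, hm'⟩ := ha
    obtain ⟨l, hl, hl'⟩ := hb
    exact ⟨m + l, by rw [Int.cast_add, hm, hl, map_add], by
      rw [ofAdd_add, map_mul, Units.val_mul, hm', hl', zpow_add₀ h0]⟩
  | hn a ha =>
    obtain ⟨m, hm, hm'⟩ := ha
    exact ⟨-m, by rw [Int.cast_neg, hm, map_neg], by
      rw [ofAdd_neg, map_inv, Units.val_inv_eq_inv_val, hm', zpow_neg]⟩

/-- The characters that vanish on the kernel of `toZMod` are the powers of the one given by `x`. -/
theorem mem_zpowers_xUnitOne_iff (hζ : IsPrimitiveRoot ζ n) (u : (augUnits n p).ker) :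
    u ∈ Subgroup.zpowers (xUnitOne n p) ↔
      ∀ σ, toZMod n p σ = 0 → toCharacter hζ u (.ofAdd σ) = 1 := by
  constructor
  · intro hu σ hσ
    obtain ⟨k, rfl⟩ := Subgroup.mem_zpowers_iff.1 hu
    obtain ⟨m, hm, hm'⟩ := exists_toCharacter_xUnitOne_eq hζ σ
    rw [hσ, ZMod.intCast_zmod_eq_zero_iff_dvd] at hm
    obtain ⟨l, rfl⟩ := hm
    have h1 : toCharacter hζ (xUnitOne n p) (.ofAdd σ) = 1 := by
      rw [Units.ext_iff, hm', zpow_mul, zpow_natCast, hζ.pow_eq_one, one_zpow, Units.val_one]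
    rw [map_zpow, MonoidHom.zpow_apply, h1, one_zpow]
  · intro h
    set φ := toCharacter hζ u with hφ
    -- Both `gen v - v • gen 1` and `n • gen 1` lie in the kernel of `toZMod`. So `φ` is determined
    -- by its value at `gen 1`, an `n`-th root of unity and hence a power `ζ ^ r`.
    have hgen (v : ZMod n) : φ (.ofAdd (gen n p v)) = φ (.ofAdd (gen n p 1)) ^ v.val := by
      have h1 := h (gen n p v - v.val • gen n p 1) (by simp [toZMod_gen])
      rwa [ofAdd_sub, map_div, div_eq_one, ofAdd_nsmul, map_pow] at h1
    have hn : (φ (.ofAdd (gen n p 1)) : K) ^ n = 1 := by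
      have h1 := h (n • gen n p 1) (by simp [toZMod_gen])
      rw [ofAdd_nsmul, map_pow] at h1
      rw [← Units.val_pow_eq_pow_val, h1, Units.val_one]
    obtain ⟨r, -, hr⟩ := hζ.eq_pow_of_pow_eq_one hn
    refine Subgroup.mem_zpowers_iff.2 ⟨r, toCharacter_injective hζ (character_ext fun v => ?_)⟩
    rw [Units.ext_iff, map_zpow, MonoidHom.zpow_apply, zpow_natCast, Units.val_pow_eq_pow_val,
      toCharacter_xUnitOne_gen, ← hφ, hgen, Units.val_pow_eq_pow_val, ← hr, ← pow_mul, ← pow_mul,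
      mul_comm]

/-- Since `p^φ(n) = 1` in `ℤ/n`, the group is killed by `p^φ(n) - 1`, which is prime to `p`. Hence
the algebraic closure has all the roots of unity that duality needs. -/
theorem neZero_exponent (hpn : p.Coprime n) :
    NeZero (Monoid.exponent (Multiplicative (sandDuneGroup n p)) : ZMod p) := by
  have hp : p.Prime := Fact.out
  have ht : (p : ZMod n) ^ 0 = (p : ZMod n) ^ n.totient := by
    rw [pow_zero, ← Nat.cast_pow, ← Nat.cast_one, eq_comm, ZMod.natCast_eq_natCast_iff]
    exact Nat.ModEq.pow_totient hpn
  have htp : 0 < n.totient := Nat.totient_pos.2 (NeZero.pos n)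
  have h1 : 1 ≤ p ^ n.totient := Nat.one_le_pow _ _ hp.pos
  have h : Monoid.exponent (Multiplicative (sandDuneGroup n p)) ∣ p ^ n.totient - 1 :=
    Monoid.exponent_dvd_of_forall_pow_eq_one fun σ =>
      nsmul_eq_zero_of_pow_eq n p (by rwa [pow_zero]) ht (Multiplicative.toAdd σ)
  refine ⟨fun h0 => ?_⟩
  rw [ZMod.natCast_eq_zero_iff] at h0
  have h2 := (Nat.dvd_sub_iff_right h1 (dvd_pow_self p htp.ne')).1 (h0.trans h)
  exact hp.one_lt.ne' (Nat.dvd_one.1 h2)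

/-- Both claims are self-duality of finite abelian groups. Characters of the kernel of `toZMod`
extend to `Σ`, so restriction is onto, and the characters it kills are the powers of the one given
by `x`. -/
theorem nonempty_addEquiv_of_coprime (hpn : p.Coprime n) :
    Nonempty (sandDuneGroup n p ≃+ Additive (augUnits n p).ker) ∧
    Nonempty ((toZMod n p).ker ≃+
      Additive ((augUnits n p).ker ⧸ Subgroup.zpowers (xUnitOne n p))) := by
  have hp : p.Prime := Fact.out
  have := SandDune.finite n p hp.two_le
  have : NeZero (n : ZMod p) := ⟨fun h => hp.one_lt.ne' (Nat.dvd_one.1 (hpn ▸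
    Nat.dvd_gcd dvd_rfl ((ZMod.natCast_eq_zero_iff _ _).1 h)))⟩
  have := neZero_exponent hpn
  obtain ⟨ζ, hζ⟩ := HasEnoughRootsOfUnity.exists_primitiveRoot (AlgebraicClosure (ZMod p)) n
  let G := Multiplicative (sandDuneGroup n p)
  let H : Subgroup G := (AddMonoidHom.toMultiplicative (toZMod n p)).ker
  have hH : HasEnoughRootsOfUnity (AlgebraicClosure (ZMod p)) (Monoid.exponent H) :=
    HasEnoughRootsOfUnity.of_dvd (n := Monoid.exponent G) _
      (Monoid.exponent_submonoid_dvd H.toSubmonoid)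
  obtain ⟨e⟩ := CommGroup.monoidHom_mulEquiv_of_hasEnoughRootsOfUnity G
    (AlgebraicClosure (ZMod p))
  obtain ⟨e'⟩ := CommGroup.monoidHom_mulEquiv_of_hasEnoughRootsOfUnity H
    (AlgebraicClosure (ZMod p))
  let ψ : (augUnits n p).ker ≃* (G →* (AlgebraicClosure (ZMod p))ˣ) :=
    MulEquiv.ofBijective (toCharacter hζ)
      ⟨toCharacter_injective hζ, toCharacter_surjective hζ hpn⟩
  let ρ : (augUnits n p).ker →* (H →* (AlgebraicClosure (ZMod p))ˣ) :=
    (MonoidHom.domRestrictHom H (AlgebraicClosure (ZMod p))ˣ).comp ψ.toMonoidHom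
  have hρ : Function.Surjective ρ :=
    (MonoidHom.domRestrict_surjective (AlgebraicClosure (ZMod p)) H).comp ψ.surjective
  have hk : ρ.ker = Subgroup.zpowers (xUnitOne n p) := by
    ext u
    rw [mem_zpowers_xUnitOne_iff hζ, MonoidHom.mem_ker]
    constructor
    · intro h σ hσ
      exact DFunLike.congr_fun h ⟨.ofAdd σ, hσ⟩
    · intro h
      ext σ
      exact congrArg Units.val (h (Multiplicative.toAdd σ.1) σ.2)
  let eH : H ≃* Multiplicative (toZMod n p).ker :=
    { toFun := fun σ => .ofAdd ⟨Multiplicative.toAdd σ.1, σ.2⟩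
      invFun := fun σ => ⟨.ofAdd σ.toAdd.1, σ.toAdd.2⟩
      left_inv := fun _ => rfl
      right_inv := fun _ => rfl
      map_mul' := fun _ _ => rfl }
  exact ⟨⟨MulEquiv.toAdditiveRight (ψ.trans e).symm⟩,
    ⟨MulEquiv.toAdditiveRight ((QuotientGroup.quotientMulEquivOfEq hk.symm).trans
      ((QuotientGroup.quotientKerEquivOfSurjective ρ hρ).trans (e'.trans eH))).symm⟩⟩

/-! ### The general case -/

/-- Induction removes one factor `p` from `n` at a time. The two claims go together because the
orders needed for the second are deduced from those of the first. -/
theorem nonempty_addEquiv (p : ℕ) [Fact p.Prime] (n : ℕ) [NeZero n] :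
    Nonempty (sandDuneGroup n p ≃+ Additive (augUnits n p).ker) ∧
    Nonempty ((toZMod n p).ker ≃+
      Additive ((augUnits n p).ker ⧸ Subgroup.zpowers (xUnitOne n p))) := by
  have hp : p.Prime := Fact.out
  have : NeZero p := ⟨hp.ne_zero⟩
  have hn : 0 < n := NeZero.pos n
  revert ‹NeZero n›
  induction n using Nat.strong_induction_on with
  | _ n ih =>
    intro _
    by_cases hpn : p ∣ n
    · obtain ⟨m, rfl⟩ := hpn
      have hm : 0 < m := Nat.pos_of_mul_pos_left hn
      have : NeZero m := ⟨hm.ne'⟩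
      have := SandDune.finite (p * m) p hp.two_le
      obtain ⟨⟨e1⟩, ⟨e2⟩⟩ := @ih m (by nlinarith [hp.two_le]) hm _
      have hc : Nat.card (sandDuneGroup (p * m) p) = Nat.card (augUnits (p * m) p).ker := by
        rw [SandDune.natCard_mul p m hp.two_le, natCard_ker_augUnits_mul, Nat.card_congr e1.toEquiv]
        rfl
      constructor
      · exact nonempty_addEquiv_of_quotient_torsion hp (SandDune.reduce p m)
          (SandDune.reduce_surjective p m) (SandDune.reduce_eq_zero_iff p m)
          (MonoidHom.toAdditive (reduceUnits p m)) (reduceUnits_surjective p m)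
          (reduceUnits_eq_one_iff p m) ⟨e1⟩ hc
      · refine nonempty_addEquiv_of_quotient_torsion hp (K := (toZMod m p).ker)
          (H := Additive ((augUnits (p * m) p).ker ⧸ Subgroup.zpowers (xUnitOne (p * m) p)))
          (L := Additive ((augUnits m p).ker ⧸ Subgroup.zpowers (xUnitOne m p)))
          (SandDune.reduceKer p m)
          (SandDune.reduceKer_surjective p m) (SandDune.reduceKer_eq_zero_iff p m)
          (MonoidHom.toAdditive (reduceQuotient p m)) (reduceQuotient_surjective p m)
          (reduceQuotient_eq_one_iff p m) ⟨e2⟩ ?_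
        -- On each side the larger group is `n` times the order of the smaller one, so the common
        -- factor cancels.
        rw [natCard_ker_toZMod, natCard_ker_augUnits] at hc
        exact Nat.eq_of_mul_eq_mul_left hn hc
    · exact nonempty_addEquiv_of_coprime ((Nat.Prime.coprime_iff_not_dvd hp).2 hpn)

end CyclicAlgebra

end

theorem mainTheorem3 (n d : ℕ) [NeZero n] [Fact d.Prime] :
    Nonempty (sandDuneGroup n d ≃+ Additive (circulantGroupOne n d)) ∧
    Nonempty (sandpileGroup n d ≃+
      Additive (circulantGroupOne n d ⧸ Subgroup.zpowers (cycUnitOne n d))) ∧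
    Nonempty ((deBruijnGraph n d).criticalGroup ≃+
      Additive (circulantGroupOne n d ⧸ Subgroup.zpowers (cycUnitOne n d))) ∧
    Nonempty (scalarCycSubgroup n d ≃* Multiplicative (ZMod (d - 1) × ZMod n)) ∧
    Nonempty ((deBruijnGraph n d).criticalGroup ≃+
      Additive (circulantGroup n d ⧸ scalarCycSubgroup n d)) := by
  obtain ⟨⟨e1⟩, ⟨e2⟩⟩ := CyclicAlgebra.nonempty_addEquiv d n
  obtain ⟨eS⟩ := SandDune.nonempty_sandpileGroup_addEquiv n d
  obtain ⟨eC⟩ := deBruijnGraph.nonempty_criticalGroup_addEquiv n d (Fact.out : d.Prime).two_le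
  obtain ⟨eH⟩ := CyclicAlgebra.nonempty_quotient_scalarCycSubgroup_mulEquiv n d
  let e3 := (eS.trans e2).trans (CyclicAlgebra.circulantOneQuotientEquiv n d).toAdditive
  exact ⟨⟨e1.trans (CyclicAlgebra.circulantOneEquiv n d).toAdditive⟩, ⟨e3⟩, ⟨eC.trans e3⟩,
    CyclicAlgebra.nonempty_scalarCycSubgroup_mulEquiv n d, ⟨(eC.trans e3).trans eH.toAdditive⟩⟩
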